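/- Let $\mathbb F$ be a field of characteristic $0$ and let $\mathcal V$ be a unital commutative associative $\mathbb F$-algebra with an $\mathbb F$-linear derivation $\partial$. Write ${\textstyle\int}:\mathcal V\to\mathcal V/\partial\mathcal V$ for the quotient map, $\mathcal V((\partial^{-1}))$ for the algebra of pseudodifferential operators over $\mathcal V$, $A(z)$ for the symbol of $A(\partial)=\sum_{n\le N}a_n\partial^n$ (replace $\partial^n$ on the right by $z^n$), $A^*(\partial)=\sum_n(-\partial)^n\circ a_n$ for its formal adjoint, $A_+=\sum_{n\ge0}a_n\partial^n$ and $\operatorname{Res}_zA(z)=a_{-1}$; $(\cdot)_+$ is applied entrywise to matrices. Let $\{\cdot\,_\lambda\,\cdot\}:\mathcal V\times\mathcal V\to\mathcal V[\lambda]$ be a $\lambda$-bracket, i.e. an $\mathbb F$-bilinear map such that, for $a,b,c\in\mathcal V$, $$\{\partial a_\lambda b\}=-\lambda\{a_\lambda b\},\quad \{a_\lambda\partial b\}=(\lambda+\partial)\{a_\lambda b\},\quad \{a_\lambda bc\}=\{a_\lambda b\}c+\{a_\lambda c\}b,$$ $$\{ab_\lambda c\}=\{a_{\lambda+x}c\}\big(\big|_{x=\partial}b\big)+\{b_{\lambda+x}c\}\big(\big|_{x=\partial}a\big),$$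 where $p(\lambda+x)(|_{x=\partial}b)=\sum_np_n(\lambda+\partial)^nb$ for $p(\lambda)=\sum_np_n\lambda^n$. (Skewsymmetry and the Jacobi identity are not assumed.) Put $$\{{\textstyle\int}f,{\textstyle\int}g\}={\textstyle\int}\{f_\lambda g\}\big|_{\lambda=0}\in\mathcal V/\partial\mathcal V,\qquad \{{\textstyle\int}f,g\}=\{f_\lambda g\}\big|_{\lambda=0}\in\mathcal V ;$$ both are well defined. The Hamiltonian equation with Hamiltonian functional ${\textstyle\int}h$ is $\frac{du}{dt}=\{{\textstyle\int}h,u\}$, $u\in\mathcal V$; a functional ${\textstyle\int}g$ is an integral of motion of it if ${\textstyle\int}\frac{dg}{dt}=0$. Let $A(\partial)$ be an $N\times N$ matrix pseudodifferential operator over $\mathcal V$ that is invertible in $\operatorname{Mat}_{N\times N}\mathcal V((\partial^{-1}))$ and of Adler type, i.e. for all $i,j,h,k\in\{1,\dots,N\}$ $$\{A_{ij}(z)_\lambda A_{hk}(w)\}=A_{hj}(w+\lambda+\partial)\,\iota_z(z-w-\lambda-\partial)^{-1}(A_{ik})^*(\lambda-z)-A_{hj}(z)\,\iota_z(z-w-\lambda-\partial)^{-1}A_{ik}(w),$$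 where $\iota_z$ denotes the geometric series expansion for large $z$. For $K\in\mathbb Z\setminus\{0\}$ and a $K$-th root $B(\partial)\in\operatorname{Mat}_{N\times N}\mathcal V((\partial^{-1}))$ of $A$ (i.e. $A=B^K$; such a $B$ is invertible) let $$h_{n,B}=-\frac{K}{n}\operatorname{Res}_z\operatorname{tr}\big(B^n(z)\big)\ \text{ for } n\in\mathbb Z\setminus\{0\},\qquad h_{0,B}=0 .$$ Then, for all nonzero integers $K,L$, all $B,C$ with $A=B^K=C^L$, and all $m,n\in\mathbb Z$: (a) $\{{\textstyle\int}h_{m,B},{\textstyle\int}h_{n,C}\}=0$. (b) The Hamiltonian flow of ${\textstyle\int}h_{n,B}$ satisfies the Lax equation $$\frac{dA(z)}{dt_{n,B}}=\{{\textstyle\int}h_{n,B},A(z)\}=[(B^n)_+,A](z),$$ and every ${\textstyle\int}h_{n,C}$ is an integral of motion of the flow of every ${\textstyle\int}h_{m,B}$. Moreover the flows are compatible: on every differential subalgebra $\mathcal W\subseteq\mathcal V$ (for example $\mathcal W=\mathcal V$) that contains $h_{m,B}$ and $h_{n,C}$, is closed under the $\lambda$-bracket and is a Poisson vertex algebra with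 it (skewsymmetry and the Jacobi identity hold on $\mathcal W$), the flows of ${\textstyle\int}h_{m,B}$ and ${\textstyle\int}h_{n,C}$ commute. -/

import Mathlib

open scoped Polynomial

namespace AdlerType

noncomputable section

section PseudoDiff

variable {F V : Type*} [Field F] [CommRing V] [Algebra F V]

/-- A scalar pseudodifferential operator `∑ₙ aₙ ∂ⁿ` (`n ≤ N` for some integer `N`, the order being
unbounded below) over the differential algebra `(V, D)`; `coeff n` is `aₙ`. -/
@[ext]
structure PseudoDiffOp (D : Derivation F V V) where
  coeff : ℤ → V
  bounded : ∃ N : ℤ, ∀ n, N < n → coeff n = 0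

namespace PseudoDiffOp

variable {D : Derivation F V V}

theorem coeff_injective : Function.Injective (coeff : PseudoDiffOp D → ℤ → V) :=
  fun _ _ h => PseudoDiffOp.ext h

instance : Zero (PseudoDiffOp D) := ⟨⟨0, 0, fun _ _ => rfl⟩⟩

/-- The identity operator `1 = 1 ∂⁰`. -/
instance : One (PseudoDiffOp D) :=
  ⟨⟨fun n => if n = 0 then 1 else 0, 0, fun n hn => if_neg (by omega)⟩⟩

instance : Add (PseudoDiffOp D) :=
  ⟨fun a b => ⟨fun n => a.coeff n + b.coeff n, by
    obtain ⟨M, hM⟩ := a.bounded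
    obtain ⟨N, hN⟩ := b.bounded
    exact ⟨max M N, fun n hn => by rw [hM n (by omega), hN n (by omega), add_zero]⟩⟩⟩

instance : Neg (PseudoDiffOp D) :=
  ⟨fun a => ⟨fun n => -a.coeff n, by
    obtain ⟨M, hM⟩ := a.bounded
    exact ⟨M, fun n hn => by rw [hM n hn, neg_zero]⟩⟩⟩

instance : Sub (PseudoDiffOp D) :=
  ⟨fun a b => ⟨fun n => a.coeff n - b.coeff n, by
    obtain ⟨M, hM⟩ := a.bounded
    obtain ⟨N, hN⟩ := b.bounded
    exact ⟨max M N, fun n hn => by rw [hM n (by omega), hN n (by omega), sub_zero]⟩⟩⟩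

instance : SMul ℕ (PseudoDiffOp D) :=
  ⟨fun k a => ⟨fun n => k • a.coeff n, by
    obtain ⟨M, hM⟩ := a.bounded
    exact ⟨M, fun n hn => by rw [hM n hn, smul_zero]⟩⟩⟩

instance : SMul ℤ (PseudoDiffOp D) :=
  ⟨fun k a => ⟨fun n => k • a.coeff n, by
    obtain ⟨M, hM⟩ := a.bounded
    exact ⟨M, fun n hn => by rw [hM n hn, smul_zero]⟩⟩⟩

instance : AddCommGroup (PseudoDiffOp D) :=
  coeff_injective.addCommGroup coeff rfl (fun _ _ => rfl) (fun _ => rfl) (fun _ _ => rfl)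
    (fun _ _ => rfl) (fun _ _ => rfl)

@[simp] theorem coeff_zero (n : ℤ) : (0 : PseudoDiffOp D).coeff n = 0 := rfl

theorem coeff_one (n : ℤ) : (1 : PseudoDiffOp D).coeff n = if n = 0 then 1 else 0 := rfl

@[simp] theorem coeff_add (a b : PseudoDiffOp D) (n : ℤ) :
    (a + b).coeff n = a.coeff n + b.coeff n := rfl

/-- The `p = (i, k)` term of the coefficient of `∂ⁿ` in `a ∘ b`; it comes from
`∂ⁱ ∘ f = ∑ₖ (i choose k) (Dᵏ f) ∂ⁱ⁻ᵏ`. -/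
def mulTerm (a b : PseudoDiffOp D) (n : ℤ) (p : ℤ × ℕ) : V :=
  Ring.choose p.1 p.2 • (a.coeff p.1 * (D.toLinearMap ^ p.2) (b.coeff (n - p.1 + p.2)))

theorem mulTerm_finite (a b : PseudoDiffOp D) (n : ℤ) :
    (mulTerm a b n).HasFiniteSupport := by
  obtain ⟨M, hM⟩ := a.bounded
  obtain ⟨N, hN⟩ := b.bounded
  refine ((Set.finite_Icc (n - N) M).prod (Set.finite_Iic (M + N - n).toNat)).subset ?_
  rintro ⟨i, k⟩ h
  have h1 : i ≤ M := by
    by_contra hc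
    exact h (by simp [mulTerm, hM i (by omega)])
  have h2 : n - i + k ≤ N := by
    by_contra hc
    exact h (by simp [mulTerm, hN (n - i + k) (by omega)])
  simp only [Set.mem_prod, Set.mem_Icc, Set.mem_Iic]
  omega

/-- Composition of pseudodifferential operators (all sums are finite). -/
instance : Mul (PseudoDiffOp D) :=
  ⟨fun a b => ⟨fun n => ∑ᶠ p : ℤ × ℕ, Ring.choose p.1 p.2 •
      (a.coeff p.1 * (D.toLinearMap ^ p.2) (b.coeff (n - p.1 + p.2))), by
    obtain ⟨M, hM⟩ := a.bounded
    obtain ⟨N, hN⟩ := b.bounded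
    refine ⟨M + N, fun n hn => finsum_eq_zero_of_forall_eq_zero ?_⟩
    rintro ⟨i, k⟩
    by_cases hi : M < i
    · simp [hM i hi]
    · simp [hN (n - i + k) (by omega)]⟩⟩

theorem coeff_mul (a b : PseudoDiffOp D) (n : ℤ) :
    (a * b).coeff n = ∑ᶠ p : ℤ × ℕ, mulTerm a b n p := rfl

theorem iterate_leibniz (D : Derivation F V V) (s : ℕ) (b c : V) :
    (D.toLinearMap ^ s) (b * c) = ∑ p ∈ Finset.HasAntidiagonal.antidiagonal s,
      (s.choose p.1) • ((D.toLinearMap ^ p.1) b * (D.toLinearMap ^ p.2) c) := by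
  induction s with
  | zero => simp
  | succ s ih =>
    rw [Finset.sum_antidiagonal_choose_succ_nsmul
      (fun i j => (D.toLinearMap ^ i) b * (D.toLinearMap ^ j) c), pow_succ', Module.End.mul_apply,
      ih, map_sum, ← Finset.sum_add_distrib]
    refine Finset.sum_congr rfl fun p hp => ?_
    have hc : s.choose p.2 = s.choose p.1 := by
      rw [← Finset.HasAntidiagonal.mem_antidiagonal.1 hp, Nat.choose_symm_add]
    rw [hc, ← smul_add, map_nsmul]
    congr 1
    simp only [pow_succ', Module.End.mul_apply, Derivation.coeFn_coe, Derivation.leibniz, smul_eq_mul]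
    ring

/-- The identity on coefficients behind associativity of the composition. -/
theorem assoc_aux (i j : ℤ) (l : ℕ) (b c : V) :
    (∑ p ∈ Finset.HasAntidiagonal.antidiagonal l, (Ring.choose i p.1 * Ring.choose j p.2) •
      (D.toLinearMap ^ p.1) (b * (D.toLinearMap ^ p.2) c)) =
    ∑ p ∈ Finset.HasAntidiagonal.antidiagonal l, (Ring.choose i p.1 * Ring.choose (i + j - p.1) p.2) •
      ((D.toLinearMap ^ p.1) b * (D.toLinearMap ^ p.2) c) := by
  have key : ∀ k r : ℕ, Ring.choose i k * Ring.choose (i + j - k) r =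
      ∑ q ∈ Finset.HasAntidiagonal.antidiagonal r,
        ((k + q.1).choose k : ℤ) * Ring.choose i (k + q.1) * Ring.choose j q.2 := by
    intro k r
    rw [show i + j - k = (i - k) + j by ring, Ring.add_choose_eq r (Commute.all _ _),
      Finset.mul_sum]
    refine Finset.sum_congr rfl fun q _ => ?_
    have := Ring.choose_smul_choose i (Nat.le_add_right k q.1)
    rw [nsmul_eq_mul, Nat.add_sub_cancel_left] at this
    rw [this, mul_assoc]
  simp_rw [key, iterate_leibniz, Finset.smul_sum, Finset.sum_smul, Finset.sum_sigma']
  refine Finset.sum_nbij'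
    (fun x => ⟨(x.2.1, x.2.2 + x.1.2), (x.2.2, x.1.2)⟩)
    (fun x => ⟨(x.1.1 + x.2.1, x.2.2), (x.1.1, x.2.1)⟩) ?_ ?_ ?_ ?_ ?_
  · rintro ⟨⟨s, t⟩, k, u⟩ h
    simp only [Finset.mem_sigma, Finset.HasAntidiagonal.mem_antidiagonal] at h ⊢
    obtain ⟨h1, h2⟩ := h
    exact ⟨by omega, trivial⟩
  · rintro ⟨⟨s, t⟩, k, u⟩ h
    simp only [Finset.mem_sigma, Finset.HasAntidiagonal.mem_antidiagonal] at h ⊢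
    obtain ⟨h1, h2⟩ := h
    exact ⟨by omega, trivial⟩
  · rintro ⟨⟨s, t⟩, k, u⟩ h
    simp only [Finset.mem_sigma, Finset.HasAntidiagonal.mem_antidiagonal] at h
    obtain ⟨h1, rfl⟩ := h
    rfl
  · rintro ⟨⟨s, t⟩, k, u⟩ h
    simp only [Finset.mem_sigma, Finset.HasAntidiagonal.mem_antidiagonal] at h
    obtain ⟨h1, rfl⟩ := h
    rfl
  · rintro ⟨⟨s, t⟩, k, u⟩ h
    simp only [Finset.mem_sigma, Finset.HasAntidiagonal.mem_antidiagonal] at h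
    obtain ⟨h1, rfl⟩ := h
    simp only [pow_add, Module.End.mul_apply]
    rw [← natCast_zsmul, smul_smul]
    congr 1
    ring

/-- A finitely supported sum over `ℕ × ℕ` grouped along antidiagonals. -/
theorem finsum_antidiagonal {M : Type*} [AddCommMonoid M] (f : ℕ × ℕ → M) (L : ℕ)
    (hL : ∀ p, L ≤ p.1 + p.2 → f p = 0) :
    ∑ᶠ p, f p = ∑ l ∈ Finset.range L, ∑ p ∈ Finset.HasAntidiagonal.antidiagonal l, f p := by
  classical
  rw [← Finset.sum_biUnion]
  · refine finsum_eq_sum_of_support_subset _ fun p hp => ?_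
    simp only [Finset.coe_biUnion, Set.mem_iUnion, Finset.mem_coe, Finset.mem_range,
      Finset.HasAntidiagonal.mem_antidiagonal, exists_prop]
    refine ⟨_, ?_, rfl⟩
    by_contra hc
    exact hp (hL p (by omega))
  · intro x _ y _ hxy
    refine Finset.disjoint_left.2 fun p hp hq => hxy ?_
    rw [← Finset.HasAntidiagonal.mem_antidiagonal.1 hp, ← Finset.HasAntidiagonal.mem_antidiagonal.1 hq]

theorem mul_assoc_aux (a b c : PseudoDiffOp D) : a * b * c = a * (b * c) := by
  obtain ⟨Na, hNa⟩ := a.bounded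
  obtain ⟨Nb, hNb⟩ := b.bounded
  obtain ⟨Nc, hNc⟩ := c.bounded
  refine PseudoDiffOp.ext (funext fun n => ?_)
  let G : (ℤ × ℤ) × (ℕ × ℕ) → V := fun q =>
    (Ring.choose q.1.1 q.2.1 * Ring.choose (q.1.1 + q.1.2 - q.2.1) q.2.2) •
      (a.coeff q.1.1 * ((D.toLinearMap ^ q.2.1) (b.coeff q.1.2) *
        (D.toLinearMap ^ q.2.2) (c.coeff (n - q.1.1 - q.1.2 + (q.2.1 + q.2.2 : ℕ)))))
  let H : (ℤ × ℤ) × (ℕ × ℕ) → V := fun q =>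
    (Ring.choose q.1.1 q.2.1 * Ring.choose q.1.2 q.2.2) •
      (a.coeff q.1.1 * (D.toLinearMap ^ q.2.1) (b.coeff q.1.2 *
        (D.toLinearMap ^ q.2.2) (c.coeff (n - q.1.1 - q.1.2 + (q.2.1 + q.2.2 : ℕ)))))
  have hbox : ∀ f : (ℤ × ℤ) × (ℕ × ℕ) → V,
      (∀ i j k r, Na < i ∨ Nb < j ∨ Nc < n - i - j + (k + r : ℕ) → f ((i, j), (k, r)) = 0) →
      f.HasFiniteSupport := by
    intro f hf
    refine (((Set.finite_Icc (n - Nc - Nb) Na).prod (Set.finite_Icc (n - Nc - Na) Nb)).prod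
      ((Set.finite_Iic (Na + Nb + Nc - n).toNat).prod
        (Set.finite_Iic (Na + Nb + Nc - n).toNat))).subset ?_
    rintro ⟨⟨i, j⟩, k, r⟩ h
    have h' : ¬ (Na < i ∨ Nb < j ∨ Nc < n - i - j + (k + r : ℕ)) := fun hc => h (hf i j k r hc)
    simp only [Set.mem_prod, Set.mem_Icc, Set.mem_Iic]
    omega
  have hG : G.HasFiniteSupport := by
    refine hbox G ?_
    rintro i j k r (h | h | h)
    · simp [G, hNa i h]
    · simp [G, hNb j h]
    · simp only [G]
      rw [hNc _ h]
      simp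
  have hH : H.HasFiniteSupport := by
    refine hbox H ?_
    rintro i j k r (h | h | h)
    · simp [H, hNa i h]
    · simp [H, hNb j h]
    · simp only [H]
      rw [hNc _ h]
      simp
  have hGH : ∑ᶠ q, G q = ∑ᶠ q, H q := by
    rw [finsum_curry G hG, finsum_curry H hH]
    refine finsum_congr ?_
    rintro ⟨i, j⟩
    have hz : ∀ p : ℕ × ℕ, (Nc - (n - i - j) + 1).toNat ≤ p.1 + p.2 →
        c.coeff (n - i - j + (p.1 + p.2 : ℕ)) = 0 := fun p hp => hNc _ (by omega)
    rw [finsum_antidiagonal _ (Nc - (n - i - j) + 1).toNat (fun p hp => by simp only [G]; rw [hz p hp]; simp),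
      finsum_antidiagonal _ (Nc - (n - i - j) + 1).toNat (fun p hp => by simp only [H]; rw [hz p hp]; simp)]
    refine Finset.sum_congr rfl fun l _ => ?_
    have := congrArg (fun v => a.coeff i * v)
      (assoc_aux (D := D) i j l (b.coeff j) (c.coeff (n - i - j + l)))
    simp only [Finset.mul_sum, mul_smul_comm] at this
    refine Eq.trans ?_ (this.symm.trans ?_)
    · refine Finset.sum_congr rfl fun p hp => ?_
      simp only [G]
      rw [Finset.HasAntidiagonal.mem_antidiagonal.1 hp]
    · refine Finset.sum_congr rfl fun p hp => ?_
      simp only [H]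
      rw [Finset.HasAntidiagonal.mem_antidiagonal.1 hp]
  let e : (ℤ × ℕ) × (ℤ × ℕ) ≃ (ℤ × ℤ) × (ℕ × ℕ) :=
    { toFun := fun x => ((x.2.1, x.1.1 - x.2.1 + x.2.2), (x.2.2, x.1.2))
      invFun := fun q => ((q.1.1 + q.1.2 - q.2.1, q.2.2), (q.1.1, q.2.1))
      left_inv := by
        rintro ⟨⟨p, r⟩, i, k⟩
        have : i + (p - i + (k : ℤ)) - k = p := by ring
        simp [this]
      right_inv := by
        rintro ⟨⟨i, j⟩, k, r⟩
        have : i + j - (k : ℤ) - i + k = j := by ring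
        simp [this] }
  let e' : (ℤ × ℕ) × (ℤ × ℕ) ≃ (ℤ × ℤ) × (ℕ × ℕ) :=
    { toFun := fun x => ((x.1.1, x.2.1), (x.1.2, x.2.2))
      invFun := fun q => ((q.1.1, q.2.1), (q.1.2, q.2.2))
      left_inv := fun _ => rfl
      right_inv := fun _ => rfl }
  have hL : (a * b * c).coeff n = ∑ᶠ q, G q := by
    rw [← finsum_comp_equiv e, finsum_curry (fun x => G (e x)) (hG.comp_of_injective e.injective), coeff_mul]
    refine finsum_congr ?_
    rintro ⟨p, r⟩
    let φ : V →+ V := (DistribSMul.toAddMonoidHom V (Ring.choose p r)).comp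
      (AddMonoidHom.mulRight ((D.toLinearMap ^ r) (c.coeff (n - p + r))))
    change φ ((a * b).coeff p) = _
    rw [coeff_mul, φ.map_finsum (mulTerm_finite a b p)]
    refine finsum_congr ?_
    rintro ⟨i, k⟩
    have h1 : i + (p - i + (k : ℤ)) - k = p := by ring
    have h2 : n - i - (p - i + (k : ℤ)) + ((k + r : ℕ) : ℤ) = n - p + r := by push_cast; ring
    simp only [φ, G, e, mulTerm, Equiv.coe_fn_mk, h1, h2, AddMonoidHom.comp_apply,
      AddMonoidHom.coe_mulRight, DistribSMul.toAddMonoidHom_apply, smul_mul_assoc, smul_smul,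
      mul_assoc]
    rw [mul_comm (Ring.choose p r)]
  have hR : (a * (b * c)).coeff n = ∑ᶠ q, H q := by
    rw [← finsum_comp_equiv e', finsum_curry (fun x => H (e' x)) (hH.comp_of_injective e'.injective), coeff_mul]
    refine finsum_congr ?_
    rintro ⟨i, s⟩
    let φ : V →+ V := (DistribSMul.toAddMonoidHom V (Ring.choose i s)).comp
      ((AddMonoidHom.mulLeft (a.coeff i)).comp (D.toLinearMap ^ s).toAddMonoidHom)
    change φ ((b * c).coeff (n - i + s)) = _
    rw [coeff_mul, φ.map_finsum (mulTerm_finite b c _)]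
    refine finsum_congr ?_
    rintro ⟨j, t⟩
    have h2 : n - i + (s : ℤ) - j + t = n - i - j + ((s + t : ℕ) : ℤ) := by push_cast; ring
    simp only [φ, H, e', mulTerm, Equiv.coe_fn_mk, h2, AddMonoidHom.comp_apply,
      AddMonoidHom.coe_mulLeft, DistribSMul.toAddMonoidHom_apply, LinearMap.toAddMonoidHom_coe,
      map_zsmul, smul_smul]
    rw [mul_comm (Ring.choose j t)]
  rw [hL, hR, hGH]

instance : Ring (PseudoDiffOp D) where
  __ := (inferInstance : AddCommGroup (PseudoDiffOp D))
  left_distrib a b c := PseudoDiffOp.ext (funext fun n => by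
    rw [coeff_add, coeff_mul, coeff_mul, coeff_mul,
      ← finsum_add_distrib (mulTerm_finite a b n) (mulTerm_finite a c n)]
    exact finsum_congr fun p => by simp [mulTerm, mul_add])
  right_distrib a b c := PseudoDiffOp.ext (funext fun n => by
    rw [coeff_add, coeff_mul, coeff_mul, coeff_mul,
      ← finsum_add_distrib (mulTerm_finite a c n) (mulTerm_finite b c n)]
    exact finsum_congr fun p => by simp [mulTerm, add_mul])
  zero_mul a := PseudoDiffOp.ext (funext fun n => by
    rw [coeff_mul]
    exact finsum_eq_zero_of_forall_eq_zero fun p => by simp [mulTerm])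
  mul_zero a := PseudoDiffOp.ext (funext fun n => by
    rw [coeff_mul]
    exact finsum_eq_zero_of_forall_eq_zero fun p => by simp [mulTerm])
  mul_assoc := mul_assoc_aux
  one_mul a := PseudoDiffOp.ext (funext fun n => by
    rw [coeff_mul, finsum_eq_single _ ((0 : ℤ), 0)]
    · simp [mulTerm, coeff_one]
    · rintro ⟨i, k⟩ h
      rcases eq_or_ne i 0 with rfl | hi
      · rcases k with _ | k
        · exact absurd rfl h
        · simp [mulTerm, Ring.choose_zero_succ]
      · simp [mulTerm, coeff_one, hi])
  mul_one a := PseudoDiffOp.ext (funext fun n => by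
    rw [coeff_mul, finsum_eq_single _ (n, 0)]
    · simp [mulTerm, coeff_one]
    · rintro ⟨i, k⟩ h
      rcases k with _ | k
      · have : n - i ≠ 0 := fun hc => h (by simp; omega)
        simp [mulTerm, coeff_one, this]
      · rcases eq_or_ne (n - i + ((k + 1 : ℕ) : ℤ)) 0 with hz | hz
        · simp only [mulTerm, coeff_one, if_pos hz]
          simp [pow_succ]
        · simp only [mulTerm, coeff_one, if_neg hz]
          simp)
  zsmul := fun k a => k • a
  zsmul_zero' := fun a => zero_zsmul a
  zsmul_succ' := fun k a => SubNegMonoid.zsmul_succ' k a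
  zsmul_neg' := fun k a => SubNegMonoid.zsmul_neg' k a
  nsmul := fun k a => k • a
  nsmul_zero := fun a => zero_nsmul a
  nsmul_succ := fun k a => AddMonoid.nsmul_succ k a

/-- The part `∑_{n ≥ 0} aₙ ∂ⁿ` of nonnegative order. -/
def posPart (a : PseudoDiffOp D) : PseudoDiffOp D :=
  ⟨fun n => if 0 ≤ n then a.coeff n else 0, by
    obtain ⟨N, hN⟩ := a.bounded
    exact ⟨N, fun n hn => by rw [hN n hn, ite_self]⟩⟩

/-- The residue: the coefficient of `∂⁻¹`. -/
def residue (a : PseudoDiffOp D) : V := a.coeff (-1)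

/-- Application of a linear map to all coefficients. -/
def mapCoeff (φ : V →ₗ[F] V) (a : PseudoDiffOp D) : PseudoDiffOp D :=
  ⟨fun n => φ (a.coeff n), by
    obtain ⟨N, hN⟩ := a.bounded
    exact ⟨N, fun n hn => by rw [hN n hn, map_zero]⟩⟩

/-- The formal adjoint `a* = ∑ₙ (-∂)ⁿ ∘ aₙ`: the coefficient of `∂ʳ` collects the terms
`(-1)ⁿ (n choose k) Dᵏ aₙ` with `n - k = r`. -/
def adjoint (a : PseudoDiffOp D) : PseudoDiffOp D :=
  ⟨fun r => ∑ᶠ k : ℕ, (((r + k).negOnePow : ℤ) * Ring.choose (r + k) k) •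
      (D.toLinearMap ^ k) (a.coeff (r + k)), by
    obtain ⟨N, hN⟩ := a.bounded
    refine ⟨N, fun n hn => finsum_eq_zero_of_forall_eq_zero fun k => ?_⟩
    rw [hN (n + k) (by omega), map_zero, smul_zero]⟩

end PseudoDiffOp

/-- Integer powers in a ring; negative powers are meaningful for units only. -/
def intPow {R : Type*} [Ring R] (b : R) : ℤ → R
  | .ofNat k => b ^ k
  | .negSucc k => Ring.inverse b ^ (k + 1)

/-- `N × N` matrix pseudodifferential operators. -/
abbrev MatPseudoDiffOp (N : ℕ) (D : Derivation F V V) : Type _ :=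
  Matrix (Fin N) (Fin N) (PseudoDiffOp D)

/-- `B` is a `K`-th root of `A`, where `K` is a nonzero integer: `A = B ^ K`. -/
def IsRoot {N : ℕ} {D : Derivation F V V} (A : MatPseudoDiffOp N D) (K : ℤ)
    (B : MatPseudoDiffOp N D) : Prop :=
  K ≠ 0 ∧ (K < 0 → IsUnit B) ∧ intPow B K = A

/-- The density `h_{n,B} = (-K/n) Res tr Bⁿ` for `n ≠ 0`, and `h_{0,B} = 0`. -/
def hamDensity {N : ℕ} {D : Derivation F V V} (K : ℤ) (B : MatPseudoDiffOp N D) (n : ℤ) : V :=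
  if n = 0 then 0
  else (-(K : F) / (n : F)) • PseudoDiffOp.residue (Matrix.trace (intPow B n))

end PseudoDiff

section Bracket

variable {F V : Type*} [Field F] [CommRing V] [Algebra F V] (D : Derivation F V V)

/-- `D` applied to the coefficients of a polynomial in `λ`. -/
def polyD : V[X] →ₗ[F] V[X] :=
  Polynomial.lsum fun n => (Polynomial.monomial n).restrictScalars F ∘ₗ D.toLinearMap

theorem coeff_polyD (p : V[X]) (n : ℕ) : (polyD D p).coeff n = D (p.coeff n) := by
  induction p using Polynomial.induction_on' with
  | add p q hp hq => simp [hp, hq]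
  | monomial k a =>
    have : polyD D (Polynomial.monomial k a) = Polynomial.monomial k (D a) := by
      simp [polyD, Polynomial.lsum, Polynomial.sum_monomial_index]
    rw [this, Polynomial.coeff_monomial, Polynomial.coeff_monomial]
    split_ifs <;> simp

/-- The operator `λ + ∂` on `V[λ]` (the polynomial variable `X` is `λ`). -/
def lamD : V[X] →ₗ[F] V[X] :=
  LinearMap.mulLeft F (Polynomial.X : V[X]) + polyD D

/-- For `p(λ) = ∑ₙ pₙ λⁿ` and `b ∈ V`, the polynomial
`p(λ + x)(|_{x = ∂} b) = ∑ₙ pₙ (λ + ∂)ⁿ b`. -/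
def shiftInto (p : V[X]) (b : V) : V[X] :=
  p.sum fun n a => Polynomial.C a * (lamD D ^ n) (Polynomial.C b)

/-- A `λ`-bracket on the differential algebra `(V, D)`: an `F`-bilinear map
`V × V → V[λ]` satisfying sesquilinearity and the left and right Leibniz rules. -/
structure LambdaBracket where
  br : V →ₗ[F] V →ₗ[F] V[X]
  sesq_left : ∀ a b, br (D a) b = -(Polynomial.X * br a b)
  sesq_right : ∀ a b, br a (D b) = lamD D (br a b)
  leibniz_right : ∀ a b c,
    br a (b * c) = br a b * Polynomial.C c + br a c * Polynomial.C b
  leibniz_left : ∀ a b c,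
    br (a * b) c = shiftInto D (br a c) b + shiftInto D (br b c) a

/-- The space of local functionals `V / ∂V`. -/
abbrev Functionals : Type _ := V ⧸ LinearMap.range D.toLinearMap

/-- The quotient map `∫ : V → V / ∂V`. -/
def integral : V →ₗ[F] Functionals D := Submodule.mkQ _

theorem integral_D (a : V) : integral D (D a) = 0 :=
  (Submodule.Quotient.mk_eq_zero _).2 ⟨a, rfl⟩

namespace LambdaBracket

variable {D} (lb : LambdaBracket D)

/-- `{f_λ g}` at `λ = 0`. -/
def atZero : V →ₗ[F] V →ₗ[F] V :=
  lb.br.compr₂ ((Polynomial.lcoeff V 0).restrictScalars F)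

theorem atZero_apply (f g : V) : lb.atZero f g = (lb.br f g).coeff 0 := rfl

/-- The action `{∫f, g} = {f_λ g}|_{λ=0}` of local functionals on `V`. The Hamiltonian equation
with Hamiltonian functional `H` is `du/dt = {H, u}`, so `lb.flow H` is the time derivative
`d/dt` on `V` along this equation. -/
def flow : Functionals D →ₗ[F] V →ₗ[F] V :=
  Submodule.liftQ _ lb.atZero (by
    rintro _ ⟨a, rfl⟩
    refine LinearMap.mem_ker.2 (LinearMap.ext fun g => ?_)
    change (lb.br (D a) g).coeff 0 = 0
    rw [lb.sesq_left]
    simp)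

theorem flow_integral (f g : V) : lb.flow (integral D f) g = (lb.br f g).coeff 0 := rfl

/-- The bracket `{∫f, ∫g} = ∫ {f_λ g}|_{λ=0}` on local functionals. -/
def funBracket : Functionals D →ₗ[F] Functionals D →ₗ[F] Functionals D :=
  (Submodule.liftQ _ (lb.flow.compr₂ (integral D)).flip (by
    rintro _ ⟨g, rfl⟩
    refine LinearMap.mem_ker.2 (LinearMap.ext fun H => ?_)
    obtain ⟨f, rfl⟩ := Submodule.Quotient.mk_surjective _ H
    change integral D ((lb.br f (D g)).coeff 0) = 0
    rw [lb.sesq_right, lamD, LinearMap.add_apply, Polynomial.coeff_add, coeff_polyD]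
    simp [integral_D])).flip

theorem funBracket_integral (f g : V) :
    lb.funBracket (integral D f) (integral D g) = integral D ((lb.br f g).coeff 0) := rfl

/-- The functional `G` is an integral of motion of the Hamiltonian equation `du/dt = {H, u}`:
for every density `g` of `G` one has `∫ dg/dt = 0`. -/
def IsIntegralOfMotion (H G : Functionals D) : Prop :=
  ∀ g : V, integral D g = G → integral D (lb.flow H g) = 0

/-- The differential subalgebra `W` is closed under the `λ`-bracket, and is a Poisson vertex
algebra with it: skewsymmetry `{b_λ a} = -(|_{x=∂} {a_{-λ-x} b})` and the Jacobi identity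
`{a_λ {b_μ c}} - {b_μ {a_λ c}} = {{a_λ b}_{λ+μ} c}` hold on `W`. In the last identity both
sides are in `V[λ][μ]`, the outer variable being `μ`. -/
structure IsPVASubalgebra (W : Subalgebra F V) : Prop where
  D_mem : ∀ a ∈ W, D a ∈ W
  br_mem : ∀ a ∈ W, ∀ b ∈ W, ∀ n, (lb.br a b).coeff n ∈ W
  skew : ∀ a ∈ W, ∀ b ∈ W,
    lb.br b a = -((lb.br a b).sum fun n c => ((-lamD D) ^ n) (Polynomial.C c))
  jacobi : ∀ a ∈ W, ∀ b ∈ W, ∀ c ∈ W,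
    ((lb.br b c).sum fun j e => Polynomial.monomial j (lb.br a e)) -
      ((lb.br a c).sum fun i e =>
        Polynomial.C (Polynomial.X ^ i) * (lb.br b e).map Polynomial.C) =
    (lb.br a b).sum fun k e => Polynomial.C (Polynomial.X ^ k) *
      (lb.br e c).eval₂ (Polynomial.C.comp Polynomial.C)
        (Polynomial.C Polynomial.X + Polynomial.X : V[X][X])

end LambdaBracket

end Bracket

section Adler

variable {F V : Type*} [Field F] [CommRing V] [Algebra F V] {D : Derivation F V V}

/-! Series in `w` (respectively in `z`, `w`) with coefficients in `V[λ]` are given by their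
coefficients `f n` of `wⁿ` (respectively `g m n` of `zᵐ wⁿ`). -/

/-- `(w + λ + ∂)ʳ f(w)`, expanded in nonnegative powers of `λ + ∂`. -/
def shiftPow (D : Derivation F V V) (r : ℤ) (f : ℤ → V[X]) : ℤ → V[X] := fun n =>
  ∑ᶠ s : ℕ, Ring.choose r s • (lamD D ^ s) (f (n - r + s))

/-- `a(w + λ + ∂) f(w)` for the symbol `a(z) = ∑ a_q z^q` of a pseudodifferential operator. -/
def symbolShift (a : PseudoDiffOp D) (f : ℤ → V[X]) : ℤ → V[X] := fun n =>
  ∑ᶠ q : ℤ, Polynomial.C (a.coeff q) * shiftPow D q f n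

/-- `ι_z (z - w - λ - ∂)⁻¹ g(z, w) = ∑_{p ≥ 0} z^{-p-1} (w + λ + ∂)^p g(z, w)`. -/
def resolvent (D : Derivation F V V) (g : ℤ → ℤ → V[X]) : ℤ → ℤ → V[X] := fun m n =>
  ∑ᶠ p : ℕ, shiftPow D p (g (m + p + 1)) n

/-- `a(z) g(z, w)` for the symbol `a(z)` of a pseudodifferential operator. -/
def symbolMul (a : PseudoDiffOp D) (g : ℤ → ℤ → V[X]) : ℤ → ℤ → V[X] := fun m n =>
  ∑ᶠ q : ℤ, Polynomial.C (a.coeff q) * g (m - q) n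

/-- `a(λ - z)` for the symbol `a(z) = ∑ a_r z^r` of a pseudodifferential operator, with
`(λ - z)^r = (-1)^r ∑_t (r choose t) (-λ)^t z^{r-t}` expanded for large `z`; it is regarded as a
series in `z`, `w` which does not involve `w`. -/
def symbolReflect (a : PseudoDiffOp D) : ℤ → ℤ → V[X] := fun m n =>
  if n = 0 then
    ∑ᶠ t : ℕ, ((m.negOnePow : ℤ) * Ring.choose (m + t) t) •
      (Polynomial.C (a.coeff (m + t)) * Polynomial.X ^ t)
  else 0

/-- The symbol `a(w)`, regarded as a series in `z`, `w` which does not involve `z`. -/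
def symbolW (a : PseudoDiffOp D) : ℤ → ℤ → V[X] := fun m n =>
  if m = 0 then Polynomial.C (a.coeff n) else 0

/-- The matrix pseudodifferential operator `A` is of Adler type with respect to the `λ`-bracket:
`{A_{ij}(z)_λ A_{hk}(w)} = A_{hj}(w+λ+∂) ι_z(z-w-λ-∂)⁻¹ (A_{ik})*(λ-z)
  - A_{hj}(z) ι_z(z-w-λ-∂)⁻¹ A_{ik}(w)`
for all indices, that is, the coefficients of `zᵐ wⁿ` of both sides agree for all `m`, `n`. -/
def IsAdlerType (lb : LambdaBracket D) {ι κ : Type*} (A : Matrix ι κ (PseudoDiffOp D)) : Prop :=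
  ∀ (i h : ι) (j k : κ) (m n : ℤ),
    lb.br ((A i j).coeff m) ((A h k).coeff n) =
      symbolShift (A h j) (resolvent D (symbolReflect (A i k).adjoint) m) n -
        symbolMul (A h j) (resolvent D (symbolW (A i k))) m n

end Adler

end

end AdlerType

open AdlerType

/-!
Expanding an operator `G` as `∑ ∂ᵐ ∘ a_m` turns the Adler identity into a statement about
coefficients: acting with `{A_{ij}(z)_λ A_{hk}(w)}|_{λ=∂}` on the `a_m` and taking the coefficient
of `wⁿ` gives that of `A_{hj} (G A_{ik})₊ - (A_{hj} G)₊ A_{ik}`. The pairing of `A_{ij}` with `G`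
formed in this way is a derivation in its first argument in the cyclic sense
`⟨XY, G⟩ = ⟨X, YG⟩ + ⟨Y, GX⟩`. It is enough to check this for `X` a function, `∂` or `∂⁻¹`, as
these generate a dense subring. Summing over the matrix entries,
`K ⟨Bⁿ, 1⟩ = n ⟨B ^ K, B ^ (n - K)⟩`, so the flow of `∫ h_{n,B}` is obtained by putting
`G = B ^ (n - K)` and `A = B ^ K`; since `A G = G A = Bⁿ`, this is the Lax equation. The same
identity for the cyclic derivation `(X, G) ↦ ∫ Res (dX/dt G)`, together with the Lax equation and
the invariance of the trace `∫ Res tr` under commutators, gives involutivity; the flows commute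
because of the Jacobi identity at `λ = μ = 0`.
-/

namespace AdlerType

noncomputable section

section Operators

variable {F V : Type*} [Field F] [CommRing V] [Algebra F V] {D : Derivation F V V}

namespace PseudoDiffOp

/-- The coefficient of `∂ⁿ` as an additive map. -/
def coeffHom (n : ℤ) : PseudoDiffOp D →+ V where
  toFun X := X.coeff n
  map_zero' := rfl
  map_add' _ _ := rfl

theorem coeff_sum {α : Type*} (s : Finset α) (X : α → PseudoDiffOp D) (n : ℤ) :
    (∑ i ∈ s, X i).coeff n = ∑ i ∈ s, (X i).coeff n :=
  map_sum (coeffHom n) X s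

/-- The subgroup of pseudodifferential operators of order at most `N`. -/
def filtration (D : Derivation F V V) (N : ℤ) : AddSubgroup (PseudoDiffOp D) where
  carrier := {X | ∀ n, N < n → X.coeff n = 0}
  zero_mem' _ _ := rfl
  add_mem' hX hY n hn := by rw [coeff_add, hX n hn, hY n hn, add_zero]
  neg_mem' hX n hn := neg_eq_zero.2 (hX n hn)

theorem exists_mem_filtration (X : PseudoDiffOp D) : ∃ N, X ∈ filtration D N := X.bounded

theorem filtration_mono {M N : ℤ} (h : M ≤ N) : filtration D M ≤ filtration D N :=
  fun _ hX n hn => hX n (h.trans_lt hn)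

theorem mul_mem_filtration {M N : ℤ} {X Y : PseudoDiffOp D} (hX : X ∈ filtration D M)
    (hY : Y ∈ filtration D N) : X * Y ∈ filtration D (M + N) := by
  refine fun n hn => finsum_eq_zero_of_forall_eq_zero fun ⟨i, k⟩ => ?_
  rcases lt_or_ge M i with hi | hi
  · simp [hX i hi]
  · simp [hY (n - i + k) (by omega)]

/-- The operator `∂ᵐ`, for an integer `m`. -/
def dPow (D : Derivation F V V) (m : ℤ) : PseudoDiffOp D :=
  ⟨fun n => if n = m then 1 else 0, m, fun _ hn => if_neg hn.ne'⟩

theorem coeff_dPow (m n : ℤ) : (dPow D m).coeff n = if n = m then 1 else 0 := rfl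

theorem dPow_mem_filtration (m : ℤ) : dPow D m ∈ filtration D m := fun _ hn => if_neg hn.ne'

theorem coeff_mul_eq_finsum (X Y : PseudoDiffOp D) (n : ℤ) :
    (X * Y).coeff n = ∑ᶠ q : ℤ, X.coeff q *
      ∑ᶠ s : ℕ, Ring.choose q s • (D.toLinearMap ^ s) (Y.coeff (n - q + s)) := by
  obtain ⟨N, hN⟩ := Y.exists_mem_filtration
  rw [coeff_mul, finsum_curry _ (mulTerm_finite X Y n)]
  refine finsum_congr fun q => ?_
  rw [mul_finsum']
  · simp only [mulTerm, mul_smul_comm]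
  · refine (Set.finite_Iic (N - n + q).toNat).subset fun s hs => ?_
    by_contra hc
    rw [Set.mem_Iic] at hc
    exact hs (by simp only [hN (n - q + s) (by omega), map_zero, smul_zero])

theorem coeff_dPow_mul (m : ℤ) (X : PseudoDiffOp D) (n : ℤ) :
    (dPow D m * X).coeff n =
      ∑ᶠ s : ℕ, Ring.choose m s • (D.toLinearMap ^ s) (X.coeff (n - m + s)) := by
  rw [coeff_mul_eq_finsum, finsum_eq_single _ m fun q hq => by rw [coeff_dPow, if_neg hq, zero_mul],
    coeff_dPow, if_pos rfl, one_mul]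

theorem coeff_mul_eq_finsum_dPow_mul (X Y : PseudoDiffOp D) (n : ℤ) :
    (X * Y).coeff n = ∑ᶠ q : ℤ, X.coeff q * (dPow D q * Y).coeff n := by
  simp only [coeff_dPow_mul, coeff_mul_eq_finsum X Y]

theorem coeff_mul_dPow (X : PseudoDiffOp D) (m n : ℤ) :
    (X * dPow D m).coeff n = X.coeff (n - m) := by
  rw [coeff_mul, finsum_eq_single _ (n - m, 0)]
  · simp [mulTerm, coeff_dPow]
  · rintro ⟨i, _ | k⟩ h
    · have hi : i ≠ n - m := fun hc => h (by rw [hc])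
      simp [mulTerm, coeff_dPow, show n - i ≠ m by omega]
    · rw [mulTerm, coeff_dPow]
      split_ifs <;> simp [pow_succ]

theorem dPow_zero : dPow D 0 = 1 := rfl

theorem dPow_mul_dPow (m n : ℤ) : dPow D m * dPow D n = dPow D (m + n) := by
  ext k
  simp only [coeff_mul_dPow, coeff_dPow, sub_eq_iff_eq_add]

theorem coeff_dPow_one_mul (X : PseudoDiffOp D) (n : ℤ) :
    (dPow D 1 * X).coeff n = X.coeff (n - 1) + D (X.coeff n) := by
  rw [coeff_dPow_mul, finsum_eq_sum_of_support_subset (s := {0, 1})]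
  · simp
  · rintro (_ | _ | s) hs
    · simp
    · simp
    · have h0 : Ring.choose (1 : ℤ) (s + 1 + 1) = 0 := by
        rw [← Nat.cast_one, Ring.choose_natCast, Nat.choose_eq_zero_of_lt (by omega), Nat.cast_zero]
      exact absurd (by simp only [h0, zero_smul]) hs

/-- The multiplication operator by an element of `V`. -/
def const (D : Derivation F V V) : V →+* PseudoDiffOp D where
  toFun a := ⟨fun n => if n = 0 then a else 0, 0, fun _ hn => if_neg hn.ne'⟩
  map_one' := rfl
  map_zero' := PseudoDiffOp.ext (funext fun _ => ite_self _)
  map_add' a b := by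
    ext n
    simp only [coeff_add]
    split_ifs <;> simp
  map_mul' a b := by
    ext n
    rw [coeff_mul, finsum_eq_single _ ((0 : ℤ), 0)]
    · simp [mulTerm]
    · rintro ⟨i, k⟩ h
      rcases eq_or_ne i 0 with rfl | hi
      · rcases k with _ | k
        · exact absurd rfl h
        · simp [mulTerm, Ring.choose_zero_succ]
      · simp [mulTerm, hi]

theorem coeff_const (a : V) (n : ℤ) : (const D a).coeff n = if n = 0 then a else 0 := rfl

theorem const_mem_filtration (a : V) : const D a ∈ filtration D 0 := fun _ hn => if_neg hn.ne'

theorem coeff_const_mul (a : V) (X : PseudoDiffOp D) (n : ℤ) :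
    (const D a * X).coeff n = a * X.coeff n := by
  rw [coeff_mul_eq_finsum_dPow_mul,
    finsum_eq_single _ 0 fun q hq => by rw [coeff_const, if_neg hq, zero_mul],
    coeff_const, if_pos rfl, dPow_zero, one_mul]

theorem coeff_mul_const (X : PseudoDiffOp D) (a : V) (n : ℤ) :
    (X * const D a).coeff n =
      ∑ᶠ k : ℕ, Ring.choose (n + k) k • (X.coeff (n + k) * (D.toLinearMap ^ k) a) := by
  have hterm (k : ℕ) : ∑ᶠ q : ℤ, mulTerm X (const D a) n (q, k) =
      Ring.choose (n + k) k • (X.coeff (n + k) * (D.toLinearMap ^ k) a) := by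
    rw [finsum_eq_single _ (n + k) fun q hq => ?_]
    · simp [mulTerm, coeff_const]
    · simp [mulTerm, coeff_const, show n - q + k ≠ 0 by omega]
  have hfin : Function.HasFiniteSupport fun p : ℕ × ℤ => mulTerm X (const D a) n p.swap :=
    (mulTerm_finite X (const D a) n).comp_of_injective Prod.swap_injective
  rw [coeff_mul, ← finsum_comp_equiv (Equiv.prodComm ℕ ℤ)]
  refine (finsum_curry _ hfin).trans ?_
  exact finsum_congr hterm

theorem residue_mul_const (X : PseudoDiffOp D) (a : V) :
    residue (X * const D a) = residue X * a := by
  rw [residue, coeff_mul_const, finsum_eq_single _ 0 fun k hk => ?_]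
  · simp [residue]
  · obtain ⟨k, rfl⟩ := Nat.exists_eq_succ_of_ne_zero hk
    rw [show (-1 + (k.succ : ℕ) : ℤ) = (k : ℕ) by push_cast; ring, Ring.choose_natCast,
      Nat.choose_succ_self, Nat.cast_zero, zero_smul]

theorem residue_dPow_mul_const (m : ℤ) (a : V) :
    residue (dPow D m * const D a) = if m = -1 then a else 0 := by
  rw [residue_mul_const, residue, coeff_dPow]
  simp only [eq_comm (a := (-1 : ℤ)), ite_mul, one_mul, zero_mul]

theorem sub_sum_const_mul_dPow_mem_filtration (X : PseudoDiffOp D) (M : ℤ) :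
    ∃ s : Finset ℤ, X - ∑ m ∈ s, const D (X.coeff m) * dPow D m ∈ filtration D M := by
  obtain ⟨N, hN⟩ := X.exists_mem_filtration
  refine ⟨Finset.Ioc M N, fun n hn => ?_⟩
  change X.coeff n - (∑ m ∈ Finset.Ioc M N, const D (X.coeff m) * dPow D m).coeff n = 0
  simp only [coeff_sum, coeff_const_mul, coeff_dPow, mul_ite, mul_one, mul_zero,
    Finset.sum_ite_eq, Finset.mem_Ioc]
  split_ifs with h
  · exact sub_self _
  · rw [hN n (by omega), sub_zero]

/-- The coefficient `ρₘ` in the expansion `X = ∑ₘ ∂ᵐ ∘ ρₘ`. -/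
def rightCoeff (m : ℤ) : PseudoDiffOp D →+ V :=
  (coeffHom (-1)).comp (AddMonoidHom.mulLeft (dPow D (-m - 1)))

theorem rightCoeff_apply (m : ℤ) (X : PseudoDiffOp D) :
    rightCoeff m X = residue (dPow D (-m - 1) * X) := rfl

theorem rightCoeff_dPow_mul (m n : ℤ) (X : PseudoDiffOp D) :
    rightCoeff m (dPow D n * X) = rightCoeff (m - n) X := by
  rw [rightCoeff_apply, rightCoeff_apply, ← mul_assoc, dPow_mul_dPow,
    show -m - 1 + n = -(m - n) - 1 by ring]

theorem rightCoeff_dPow_mul_const (m n : ℤ) (a : V) :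
    rightCoeff m (dPow D n * const D a) = if m = n then a else 0 := by
  rw [rightCoeff_apply, ← mul_assoc, dPow_mul_dPow, residue_dPow_mul_const]
  exact if_congr (by omega) rfl rfl

theorem rightCoeff_of_mem_filtration {N : ℤ} {X : PseudoDiffOp D} (hX : X ∈ filtration D N) :
    rightCoeff N X = X.coeff N := by
  rw [rightCoeff_apply, residue, coeff_dPow_mul, finsum_eq_single _ 0 fun s hs => ?_]
  · simp [show -1 - (-N - 1) = N by ring]
  · rw [hX _ (by omega), map_zero, smul_zero]

theorem rightCoeff_eq_zero {m N : ℤ} {X : PseudoDiffOp D} (hX : X ∈ filtration D N)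
    (h : N < m) : rightCoeff m X = 0 := by
  rw [rightCoeff_of_mem_filtration (filtration_mono h.le hX), hX m h]

theorem mem_filtration_of_rightCoeff {M : ℤ} {X : PseudoDiffOp D}
    (h : ∀ m, M < m → rightCoeff m X = 0) : X ∈ filtration D M := by
  obtain ⟨N, hN⟩ := X.exists_mem_filtration
  have descend (k : ℕ) : ∀ N, N ≤ M + k → X ∈ filtration D N → X ∈ filtration D M := by
    induction k with
    | zero => exact fun N hle hX => filtration_mono (by omega) hX
    | succ k ih =>
      intro N hle hX
      rcases le_or_gt N M with hNM | hNM
      · exact filtration_mono hNM hX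
      refine ih (N - 1) (by omega) fun n hn => ?_
      rcases eq_or_ne n N with rfl | hne
      · rw [← rightCoeff_of_mem_filtration hX, h n hNM]
      · exact hX n (by omega)
  exact descend (N - M).toNat N (by omega) hN

theorem dPow_mul_const_mem_filtration (m : ℤ) (a : V) :
    dPow D m * const D a ∈ filtration D m := by
  simpa only [add_zero] using mul_mem_filtration (dPow_mem_filtration m) (const_mem_filtration a)

theorem map_eq_finsum_rightCoeff {E : Type*} [AddCommGroup E] (φ : PseudoDiffOp D →+ E) {M : ℤ}
    (hφ : ∀ X ∈ filtration D M, φ X = 0) (X : PseudoDiffOp D) :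
    φ X = ∑ᶠ m : ℤ, φ (dPow D m * const D (rightCoeff m X)) := by
  obtain ⟨N, hN⟩ := X.exists_mem_filtration
  have hrest : X - ∑ m ∈ Finset.Ioc M N, dPow D m * const D (rightCoeff m X) ∈
      filtration D M := by
    refine mem_filtration_of_rightCoeff fun k hk => ?_
    simp only [map_sub, map_sum, rightCoeff_dPow_mul_const, Finset.sum_ite_eq, Finset.mem_Ioc]
    split_ifs with h
    · exact sub_self _
    · rw [rightCoeff_eq_zero hN (by omega), sub_zero]
  rw [sub_eq_zero.1 ((map_sub φ _ _).symm.trans (hφ _ hrest)), map_sum]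
  refine (finsum_eq_sum_of_support_subset _ fun m hm => ?_).symm
  by_contra hc
  rw [Finset.coe_Ioc, Set.mem_Ioc, not_and_or, not_lt, not_le] at hc
  refine hm ?_
  rcases hc with hc | hc
  · exact hφ _ (filtration_mono hc (dPow_mul_const_mem_filtration m _))
  · simp only [rightCoeff_eq_zero hN hc, map_zero, mul_zero]

/-- The subring of differential operators, i.e. of operators without negative powers of `∂`. -/
def diffOps (D : Derivation F V V) : Subring (PseudoDiffOp D) where
  carrier := {X | ∀ n < 0, X.coeff n = 0}
  zero_mem' _ _ := rfl
  one_mem' _ hn := if_neg hn.ne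
  add_mem' hX hY n hn := by rw [coeff_add, hX n hn, hY n hn, add_zero]
  neg_mem' hX n hn := neg_eq_zero.2 (hX n hn)
  mul_mem' {X Y} hX hY n hn := by
    refine finsum_eq_zero_of_forall_eq_zero fun ⟨i, k⟩ => ?_
    rcases lt_or_ge i 0 with hi | hi
    · simp [hX i hi]
    rcases lt_or_ge (n - i + k) 0 with hk | hk
    · simp [hY _ hk]
    lift i to ℕ using hi
    rw [Ring.choose_natCast, Nat.choose_eq_zero_of_lt (by omega), Nat.cast_zero, zero_smul]

theorem const_mem_diffOps (a : V) : const D a ∈ diffOps D := fun _ hn => if_neg hn.ne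

theorem dPow_mem_diffOps {m : ℤ} (hm : 0 ≤ m) : dPow D m ∈ diffOps D :=
  fun _ hn => if_neg (by omega)

theorem posPart_mem_diffOps (X : PseudoDiffOp D) : X.posPart ∈ diffOps D :=
  fun _ hn => if_neg hn.not_ge

theorem sub_posPart_mem_filtration (X : PseudoDiffOp D) :
    X - X.posPart ∈ filtration D (-1) := fun n hn => by
  change X.coeff n - (if 0 ≤ n then X.coeff n else 0) = 0
  rw [if_pos (by omega), sub_self]

theorem posPart_eq_of_sub_mem {X Y : PseudoDiffOp D} (hY : Y ∈ diffOps D)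
    (h : X - Y ∈ filtration D (-1)) : X.posPart = Y := by
  ext n
  change (if 0 ≤ n then X.coeff n else 0) = _
  split_ifs with hn
  · exact sub_eq_zero.1 (h n (by omega))
  · rw [hY n (by omega)]

theorem posPart_of_mem_diffOps {X : PseudoDiffOp D} (hX : X ∈ diffOps D) : X.posPart = X :=
  posPart_eq_of_sub_mem hX (by rw [sub_self]; exact zero_mem _)

theorem posPart_of_mem_filtration {X : PseudoDiffOp D} (hX : X ∈ filtration D (-1)) :
    X.posPart = 0 :=
  posPart_eq_of_sub_mem (zero_mem _) (by rwa [sub_zero])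

/-- The projection `X ↦ X₊` as an additive map. -/
def posPartHom (D : Derivation F V V) : PseudoDiffOp D →+ PseudoDiffOp D :=
  AddMonoidHom.mk' posPart fun X Y =>
    posPart_eq_of_sub_mem (add_mem X.posPart_mem_diffOps Y.posPart_mem_diffOps) (by
      rw [add_sub_add_comm]
      exact add_mem X.sub_posPart_mem_filtration Y.sub_posPart_mem_filtration)

theorem posPart_mul_const (X : PseudoDiffOp D) (a : V) :
    (X * const D a).posPart = X.posPart * const D a :=
  posPart_eq_of_sub_mem (mul_mem X.posPart_mem_diffOps (const_mem_diffOps a)) (by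
    rw [← sub_mul]
    simpa only [add_zero] using
      mul_mem_filtration X.sub_posPart_mem_filtration (const_mem_filtration a))

theorem posPart_dPow (m : ℤ) : (dPow D m).posPart = if 0 ≤ m then dPow D m else 0 := by
  split_ifs with hm
  · exact posPart_of_mem_diffOps (dPow_mem_diffOps hm)
  · exact posPart_of_mem_filtration (filtration_mono (by omega) (dPow_mem_filtration m))

theorem coeff_posPart_mul_dPow_mul (X Y : PseudoDiffOp D) (m n : ℤ) :
    ((X * dPow D m).posPart * Y).coeff n =
      ∑ᶠ q : ℤ, X.coeff q * ((dPow D (q + m)).posPart * Y).coeff n := by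
  rw [coeff_mul_eq_finsum_dPow_mul, ← finsum_comp_equiv (Equiv.addRight m)]
  refine finsum_congr fun q => ?_
  change (if 0 ≤ q + m then (X * dPow D m).coeff (q + m) else 0) * _ = _
  rw [coeff_mul_dPow, add_sub_cancel_right, posPart_dPow]
  split_ifs <;> simp

theorem finsum_int_eq_finsum_nat {M : Type*} [AddCommMonoid M] {f : ℤ → M}
    (hf : ∀ m < 0, f m = 0) : ∑ᶠ m, f m = ∑ᶠ p : ℕ, f p := by
  rw [← finsum_mem_range Nat.cast_injective, ← finsum_mem_univ]
  refine finsum_mem_inter_support_eq _ _ _ (Set.ext fun m => and_congr_left fun hm => ?_)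
  exact iff_of_true trivial ⟨m.toNat, Int.toNat_of_nonneg (not_lt.1 fun hlt => hm (hf m hlt))⟩

theorem posPart_eq_finsum_rightCoeff (X : PseudoDiffOp D) :
    X.posPart = ∑ᶠ p : ℕ, dPow D p * const D (rightCoeff p X) := by
  have hexp := map_eq_finsum_rightCoeff (posPartHom D) (M := -1)
    (fun _ => posPart_of_mem_filtration) X
  change X.posPart = ∑ᶠ m : ℤ, (dPow D m * const D (rightCoeff m X)).posPart at hexp
  simp only [posPart_mul_const, posPart_dPow] at hexp
  rw [hexp, finsum_int_eq_finsum_nat fun m hm => by rw [if_neg hm.not_ge, zero_mul]]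
  simp only [Int.natCast_nonneg, if_true]

theorem dense_induction {p : PseudoDiffOp D → Prop} (const : ∀ a, p (const D a))
    (dPow_one : p (dPow D 1)) (dPow_neg_one : p (dPow D (-1)))
    (add : ∀ X Y, p X → p Y → p (X + Y)) (mul : ∀ X Y, p X → p Y → p (X * Y))
    (limit : ∀ X, (∀ M, ∃ Y, p Y ∧ X - Y ∈ filtration D M) → p X) (X : PseudoDiffOp D) : p X := by
  have dPow (m : ℤ) : p (dPow D m) := by
    induction m with
    | zero => simpa only [map_one, dPow_zero] using const 1
    | succ m ih => simpa only [dPow_mul_dPow] using mul _ _ ih dPow_one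
    | pred m ih => simpa only [dPow_mul_dPow, sub_eq_add_neg] using mul _ _ ih dPow_neg_one
  have zero : p 0 := by simpa only [map_zero] using const 0
  refine limit X fun M => ?_
  obtain ⟨s, hs⟩ := X.sub_sum_const_mul_dPow_mem_filtration M
  exact ⟨_, Finset.sum_induction _ p add zero fun m _ => mul _ _ (const _) (dPow m), hs⟩

theorem dPow_one_mul_dPow_neg_one : dPow D 1 * dPow D (-1) = 1 := dPow_mul_dPow 1 (-1)

theorem dPow_neg_one_mul_dPow_one : dPow D (-1) * dPow D 1 = 1 := dPow_mul_dPow (-1) 1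

theorem residue_mul_dPow_one (X : PseudoDiffOp D) :
    residue (X * dPow D 1) = residue (dPow D 1 * X) - D (residue X) := by
  rw [residue, residue, residue, coeff_mul_dPow, coeff_dPow_one_mul, add_sub_cancel_right]

theorem residue_const_mul (a : V) (X : PseudoDiffOp D) :
    residue (const D a * X) = a * residue X :=
  coeff_const_mul a X (-1)

theorem residue_mul_eq_zero {M N : ℤ} {X Y : PseudoDiffOp D} (hX : X ∈ filtration D M)
    (hY : Y ∈ filtration D N) (h : M + N < -1) : residue (X * Y) = 0 :=
  mul_mem_filtration hX hY (-1) h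

theorem map_residue_mul_comm {E : Type*} [AddCommGroup E] (ρ : V →+ E) (hρ : ∀ a, ρ (D a) = 0)
    (X Y : PseudoDiffOp D) : ρ (residue (X * Y)) = ρ (residue (Y * X)) := by
  have hD (Z : PseudoDiffOp D) : ρ (residue (Z * dPow D 1)) = ρ (residue (dPow D 1 * Z)) := by
    rw [residue_mul_dPow_one, map_sub, hρ, sub_zero]
  induction X using dense_induction generalizing Y with
  | const a => rw [residue_const_mul, residue_mul_const, mul_comm]
  | dPow_one => exact (hD Y).symm
  | dPow_neg_one =>
    have h := hD (dPow D (-1) * Y * dPow D (-1))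
    rw [mul_assoc, dPow_neg_one_mul_dPow_one, mul_one, mul_assoc, ← mul_assoc (dPow D 1),
      dPow_one_mul_dPow_neg_one, one_mul] at h
    exact h
  | add X X' hX hX' =>
    have hres (Z Z' : PseudoDiffOp D) : residue (Z + Z') = residue Z + residue Z' := rfl
    rw [add_mul, mul_add, hres, hres, map_add, map_add, hX, hX']
  | mul X X' hX hX' => rw [mul_assoc, hX, mul_assoc, hX', mul_assoc]
  | limit X h =>
    obtain ⟨N, hN⟩ := Y.exists_mem_filtration
    obtain ⟨X', hcomm, hX'⟩ := h (-N - 2)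
    have hl := residue_mul_eq_zero hX' hN (by omega)
    have hr := residue_mul_eq_zero hN hX' (by omega)
    rw [sub_mul] at hl
    rw [mul_sub] at hr
    have hl' : residue (X * Y) = residue (X' * Y) := sub_eq_zero.1 hl
    have hr' : residue (Y * X) = residue (Y * X') := sub_eq_zero.1 hr
    rw [hl', hr', hcomm]

end PseudoDiffOp

end Operators

section CyclicDerivation

variable {R E : Type*} [Ring R] [AddCommGroup E]

/-- Cyclic derivations: `ω x g` stands for the trace of `δx · g`, where `δ` is a derivation. -/
def IsCyclicDerivation (ω : R →+ R →+ E) : Prop :=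
  ∀ x y g, ω (x * y) g = ω x (y * g) + ω y (g * x)

namespace IsCyclicDerivation

variable {ω : R →+ R →+ E} (hω : IsCyclicDerivation ω)
include hω

theorem one_left (g : R) : ω 1 g = 0 := by
  simpa using hω 1 1 g

theorem units_zpow (u : Rˣ) (n m : ℤ) :
    ω ↑(u ^ n) ↑(u ^ m) = n • ω ↑u ↑(u ^ (n + m - 1)) := by
  have hmul (k l m : ℤ) : ω ↑(u ^ (k + l)) ↑(u ^ m) =
      ω ↑(u ^ k) ↑(u ^ (l + m)) + ω ↑(u ^ l) ↑(u ^ (m + k)) := by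
    rw [zpow_add, Units.val_mul, hω, ← Units.val_mul, ← Units.val_mul, ← zpow_add, ← zpow_add]
  induction n generalizing m with
  | zero => simpa using hω.one_left _
  | succ n ih =>
    rw [hmul, ih, zpow_one, add_smul, one_smul]
    congr 4 <;> ring_nf
  | pred n ih =>
    have h := hmul (-n - 1) 1 (m - 1)
    rw [sub_add_cancel, ih, zpow_one, add_sub_cancel] at h
    rw [sub_smul, one_smul, eq_sub_iff_add_eq]
    refine Eq.trans ?_ (h.symm.trans ?_)
    · congr 4; ring_nf
    · congr 4; ring_nf

/-- Both sides are `n K tr(δu u ^ (n - 1))`. -/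
theorem zsmul_zpow_one (u : Rˣ) (K n : ℤ) :
    K • ω ↑(u ^ n) 1 = n • ω ↑(u ^ K) ↑(u ^ (n - K)) := by
  have h := hω.units_zpow u n 0
  rw [zpow_zero, Units.val_one, add_zero] at h
  rw [h, hω.units_zpow, smul_smul, smul_smul, mul_comm, add_sub_cancel]

end IsCyclicDerivation

/-- The pairing `∑ᵢⱼ ω(Xᵢⱼ, Gⱼᵢ)` of square matrices, i.e. the trace of the matrix of the
`ω`-products. -/
def matrixPairing {ι : Type*} [Fintype ι] (ω : R →+ R →+ E) :
    Matrix ι ι R →+ Matrix ι ι R →+ E :=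
  AddMonoidHom.mk' (fun X => AddMonoidHom.mk' (fun G => ∑ i, ∑ j, ω (X i j) (G j i)) fun G H => by
    simp only [Matrix.add_apply, map_add, Finset.sum_add_distrib]) fun X Y => by
    ext G
    simp only [AddMonoidHom.mk'_apply, Matrix.add_apply, map_add, AddMonoidHom.add_apply,
      Finset.sum_add_distrib]

theorem matrixPairing_apply {ι : Type*} [Fintype ι] (ω : R →+ R →+ E) (X G : Matrix ι ι R) :
    matrixPairing ω X G = ∑ i, ∑ j, ω (X i j) (G j i) := rfl

theorem IsCyclicDerivation.matrixPairing {ι : Type*} [Fintype ι] [DecidableEq ι]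
    {ω : R →+ R →+ E} (hω : IsCyclicDerivation ω) :
    IsCyclicDerivation (matrixPairing (ι := ι) ω) := by
  intro X Y G
  have hentry (i j k : ι) : ω (X i k * Y k j) (G j i) =
      ω (X i k) (Y k j * G j i) + ω (Y k j) (G j i * X i k) := hω _ _ _
  simp only [matrixPairing_apply, Matrix.mul_apply, map_sum, AddMonoidHom.finsetSum_apply, hentry,
    Finset.sum_add_distrib]
  congr 1
  · exact Finset.sum_congr rfl fun i _ => Finset.sum_comm
  · rw [Finset.sum_comm_cycle]
    exact Finset.sum_congr rfl fun _ _ => Finset.sum_comm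

theorem matrixPairing_one_right {ι : Type*} [Fintype ι] [DecidableEq ι] (ω : R →+ R →+ E)
    (X : Matrix ι ι R) : matrixPairing ω X 1 = ω X.trace 1 := by
  simp only [matrixPairing_apply, Matrix.one_apply, apply_ite, map_zero, Finset.sum_ite_eq',
    Finset.mem_univ, if_true, Matrix.trace, Matrix.diag, map_sum, AddMonoidHom.finsetSum_apply]

end CyclicDerivation

section Pairing

variable {F V E : Type*} [Field F] [CommRing V] [Algebra F V] {D : Derivation F V V}
  [AddCommGroup E]

/-- The properties of `β a b = ∫ b δa`, where `δ` is a derivation commuting with `∂`, and of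
`β a b = {a_∂ c}b`, that make `pairing β` a cyclic derivation. -/
structure IsDerivationPairing (D : Derivation F V V) (β : V →+ V →+ E) : Prop where
  isCyclicDerivation : IsCyclicDerivation β
  deriv : ∀ a b, β (D a) b = -β a (D b)

open PseudoDiffOp

theorem pairing_finite (β : V →+ V →+ E) (X G : PseudoDiffOp D) :
    Function.HasFiniteSupport fun m : ℤ => β (X.coeff m) (residue (dPow D m * G)) := by
  obtain ⟨M, hM⟩ := X.exists_mem_filtration
  obtain ⟨N, hN⟩ := G.exists_mem_filtration
  refine (Set.finite_Icc (-1 - N) M).subset fun m hm => ?_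
  by_contra hc
  rw [Set.mem_Icc, not_and_or, not_le, not_le] at hc
  refine hm ?_
  rcases hc with hc | hc
  · simp only [residue_mul_eq_zero (dPow_mem_filtration m) hN (by omega), map_zero]
  · simp only [hM m hc, map_zero, AddMonoidHom.zero_apply]

/-- The pairing `∑ₘ β(xₘ, Res(∂ᵐ G))` of `X = ∑ₘ xₘ ∂ᵐ` and `G`, which extends `β` to
pseudodifferential operators. -/
def pairing (β : V →+ V →+ E) : PseudoDiffOp D →+ PseudoDiffOp D →+ E :=
  AddMonoidHom.mk' (fun X => AddMonoidHom.mk'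
    (fun G => ∑ᶠ m : ℤ, β (X.coeff m) (residue (dPow D m * G))) fun G H => by
      rw [← finsum_add_distrib (pairing_finite β X G) (pairing_finite β X H)]
      simp only [mul_add, residue, coeff_add, map_add]) fun X Y => by
    ext G
    simp only [AddMonoidHom.mk'_apply, AddMonoidHom.add_apply, coeff_add, map_add]
    exact finsum_add_distrib (pairing_finite β X G) (pairing_finite β Y G)

variable (β : V →+ V →+ E)

theorem pairing_apply (X G : PseudoDiffOp D) :
    pairing β X G = ∑ᶠ m : ℤ, β (X.coeff m) (residue (dPow D m * G)) := rfl

theorem pairing_eq_zero {M N : ℤ} {X G : PseudoDiffOp D} (hX : X ∈ filtration D M)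
    (hG : G ∈ filtration D N) (h : M + N < -1) : pairing β X G = 0 := by
  refine finsum_eq_zero_of_forall_eq_zero fun m => ?_
  rcases lt_or_ge M m with hm | hm
  · rw [hX m hm, map_zero, AddMonoidHom.zero_apply]
  · rw [residue_mul_eq_zero (dPow_mem_filtration m) hG (by omega), map_zero]

theorem pairing_const (a : V) (G : PseudoDiffOp D) :
    pairing β (const D a) G = β a (residue G) := by
  rw [pairing_apply, finsum_eq_single _ 0 fun m hm => by
      rw [coeff_const, if_neg hm, map_zero, AddMonoidHom.zero_apply],
    coeff_const, if_pos rfl, dPow_zero, one_mul]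

theorem pairing_dPow (m : ℤ) (G : PseudoDiffOp D) :
    pairing β (dPow D m) G = β 1 (residue (dPow D m * G)) := by
  rw [pairing_apply, finsum_eq_single _ m fun k hk => by
      rw [coeff_dPow, if_neg hk, map_zero, AddMonoidHom.zero_apply],
    coeff_dPow, if_pos rfl]

theorem pairing_one_right (X : PseudoDiffOp D) : pairing β X 1 = β (residue X) 1 := by
  rw [pairing_apply, finsum_eq_single _ (-1) fun m hm => by
      rw [mul_one, residue, coeff_dPow, if_neg hm.symm, map_zero],
    mul_one, residue, coeff_dPow, if_pos rfl, residue]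

theorem pairing_dPow_mul_const (X : PseudoDiffOp D) (m : ℤ) (a : V) :
    pairing β X (dPow D m * const D a) = β (X.coeff (-m - 1)) a := by
  simp only [pairing_apply, ← mul_assoc, dPow_mul_dPow, residue_dPow_mul_const]
  rw [finsum_eq_single _ (-m - 1) fun k hk => by rw [if_neg (by omega), map_zero],
    if_pos (by omega)]

theorem pairing_mul_dPow (X : PseudoDiffOp D) (m : ℤ) (G : PseudoDiffOp D) :
    pairing β (X * dPow D m) G = pairing β X (dPow D m * G) := by
  simp only [pairing_apply, coeff_mul_dPow, ← mul_assoc, dPow_mul_dPow]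
  rw [← finsum_comp_equiv (Equiv.addRight m)]
  simp only [Equiv.coe_addRight, add_sub_cancel_right]

variable {β} (hβ : IsDerivationPairing D β)
include hβ

theorem IsDerivationPairing.pairing_const_mul (a : V) (Y G : PseudoDiffOp D) :
    pairing β (const D a * Y) G =
      pairing β (const D a) (Y * G) + pairing β Y (G * const D a) := by
  have hterm (m : ℤ) : β ((const D a * Y).coeff m) (residue (dPow D m * G)) =
      β a (Y.coeff m * residue (dPow D m * G)) +
        β (Y.coeff m) (residue (dPow D m * (G * const D a))) := by
    rw [coeff_const_mul, hβ.isCyclicDerivation, ← mul_assoc, residue_mul_const]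
  have hfin : Function.HasFiniteSupport fun m : ℤ => Y.coeff m * residue (dPow D m * G) :=
    pairing_finite AddMonoidHom.mul Y G
  have hfin' : Function.HasFiniteSupport fun m : ℤ =>
      β a (Y.coeff m * residue (dPow D m * G)) :=
    hfin.subset (Function.support_comp_subset (map_zero (β a)) _)
  rw [pairing_apply, finsum_congr hterm, finsum_add_distrib hfin' (pairing_finite β Y _),
    ← map_finsum _ hfin, pairing_const, residue, coeff_mul_eq_finsum_dPow_mul]
  rfl

theorem IsDerivationPairing.pairing_dPow_one_mul (Y G : PseudoDiffOp D) :
    pairing β (dPow D 1 * Y) G = pairing β Y (G * dPow D 1) := by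
  have hterm (m : ℤ) : β ((dPow D 1 * Y - Y * dPow D 1).coeff m) (residue (dPow D m * G)) =
      β (Y.coeff m) (residue (dPow D m * (G * dPow D 1))) -
        β (Y.coeff m) (residue (dPow D m * (dPow D 1 * G))) := by
    have hcomm : (dPow D 1 * Y - Y * dPow D 1).coeff m = D (Y.coeff m) := by
      change (dPow D 1 * Y).coeff m - (Y * dPow D 1).coeff m = _
      rw [coeff_dPow_one_mul, coeff_mul_dPow, add_sub_cancel_left]
    have hshift : residue (dPow D m * (dPow D 1 * G)) =
        residue (dPow D 1 * (dPow D m * G)) := by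
      rw [← mul_assoc, ← mul_assoc, dPow_mul_dPow, dPow_mul_dPow, add_comm]
    rw [hcomm, hβ.deriv, ← mul_assoc, residue_mul_dPow_one, hshift, ← map_sub,
      sub_sub_cancel_left, map_neg]
  have hsub : pairing β (dPow D 1 * Y - Y * dPow D 1) G =
      pairing β Y (G * dPow D 1) - pairing β Y (dPow D 1 * G) := by
    rw [pairing_apply, finsum_congr hterm,
      finsum_sub_distrib (pairing_finite β Y _) (pairing_finite β Y _)]
    rfl
  rwa [map_sub, AddMonoidHom.sub_apply, pairing_mul_dPow, sub_left_inj] at hsub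

theorem IsDerivationPairing.isCyclicDerivation_pairing :
    IsCyclicDerivation (pairing (D := D) β) := by
  have hdPow (m : ℤ) (G : PseudoDiffOp D) : pairing β (dPow D m) G = 0 := by
    rw [pairing_dPow, hβ.isCyclicDerivation.one_left]
  intro X Y G
  induction X using dense_induction generalizing Y G with
  | const a => exact hβ.pairing_const_mul a Y G
  | dPow_one => rw [hβ.pairing_dPow_one_mul, hdPow, zero_add]
  | dPow_neg_one =>
    have h := hβ.pairing_dPow_one_mul (dPow D (-1) * Y) (G * dPow D (-1))
    rw [← mul_assoc, dPow_one_mul_dPow_neg_one, one_mul, mul_assoc, dPow_neg_one_mul_dPow_one,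
      mul_one] at h
    rw [hdPow, zero_add, h]
  | add X X' hX hX' =>
    simp only [add_mul, mul_add, map_add, AddMonoidHom.add_apply, hX, hX', add_add_add_comm]
  | mul X X' hX hX' =>
    rw [mul_assoc, hX, hX', hX X', mul_assoc, mul_assoc, mul_assoc, add_assoc]
  | limit X h =>
    obtain ⟨M, hM⟩ := Y.exists_mem_filtration
    obtain ⟨N, hN⟩ := G.exists_mem_filtration
    obtain ⟨X', hX', hsub⟩ := h (-M - N - 2)
    have h₁ := pairing_eq_zero β (mul_mem_filtration hsub hM) hN (by omega)
    have h₂ := pairing_eq_zero β hsub (mul_mem_filtration hM hN) (by omega)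
    have h₃ := pairing_eq_zero β hM (mul_mem_filtration hN hsub) (by omega)
    rw [sub_mul, map_sub, AddMonoidHom.sub_apply, sub_eq_zero] at h₁
    rw [map_sub, AddMonoidHom.sub_apply, sub_eq_zero] at h₂
    rw [mul_sub, map_sub, sub_eq_zero] at h₃
    rw [h₁, h₂, h₃, hX']

end Pairing

section Action

variable {F V : Type*} [Field F] [CommRing V] [Algebra F V] {D : Derivation F V V}

theorem polyD_monomial (n : ℕ) (a : V) :
    polyD D (Polynomial.monomial n a) = Polynomial.monomial n (D a) := by
  ext k
  rw [coeff_polyD, Polynomial.coeff_monomial, Polynomial.coeff_monomial]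
  split_ifs <;> simp

/-- The value `p(∂) a` of the differential operator obtained from `p(λ)` by putting `λ = ∂`, with
the coefficients of `p` on the left. -/
def actOn (D : Derivation F V V) : V[X] →ₗ[F] V →ₗ[F] V :=
  Polynomial.lsum fun n => (LinearMap.mul F V).compl₂ (D.toLinearMap ^ n)

theorem actOn_monomial (n : ℕ) (x a : V) :
    actOn D (Polynomial.monomial n x) a = x * (D.toLinearMap ^ n) a := by
  simp [actOn, Polynomial.lsum, Polynomial.sum_monomial_index]

theorem actOn_C (x a : V) : actOn D (Polynomial.C x) a = x * a :=
  actOn_monomial 0 x a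

theorem actOn_C_mul (x : V) (p : V[X]) (a : V) :
    actOn D (Polynomial.C x * p) a = x * actOn D p a := by
  induction p using Polynomial.induction_on' with
  | add p q hp hq => simp only [mul_add, map_add, LinearMap.add_apply, hp, hq]
  | monomial n y => rw [Polynomial.C_mul_monomial, actOn_monomial, actOn_monomial, mul_assoc]

theorem actOn_X_mul (p : V[X]) (a : V) : actOn D (Polynomial.X * p) a = actOn D p (D a) := by
  induction p using Polynomial.induction_on' with
  | add p q hp hq => simp only [mul_add, map_add, LinearMap.add_apply, hp, hq]
  | monomial n x =>
    rw [Polynomial.X_mul_monomial, actOn_monomial, actOn_monomial, pow_succ]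
    rfl

theorem actOn_lamD (p : V[X]) (a : V) : actOn D (lamD D p) a = D (actOn D p a) := by
  induction p using Polynomial.induction_on' with
  | add p q hp hq => simp only [map_add, LinearMap.add_apply, hp, hq]
  | monomial n x =>
    rw [lamD, LinearMap.add_apply, LinearMap.mulLeft_apply, Polynomial.X_mul_monomial,
      polyD_monomial, map_add, LinearMap.add_apply, actOn_monomial, actOn_monomial, actOn_monomial,
      D.leibniz, smul_eq_mul, smul_eq_mul, mul_comm _ (D x), pow_succ']
    rfl

theorem actOn_lamD_pow (k : ℕ) (p : V[X]) (a : V) :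
    actOn D ((lamD D ^ k) p) a = (D.toLinearMap ^ k) (actOn D p a) := by
  induction k with
  | zero => rfl
  | succ k ih =>
    rw [pow_succ', pow_succ', Module.End.mul_apply, Module.End.mul_apply, actOn_lamD, ih]
    rfl

theorem actOn_one_right (p : V[X]) : actOn D p 1 = p.coeff 0 := by
  induction p using Polynomial.induction_on' with
  | add p q hp hq => rw [map_add, LinearMap.add_apply, hp, hq, Polynomial.coeff_add]
  | monomial n x =>
    rw [actOn_monomial, Polynomial.coeff_monomial]
    rcases n with _ | n
    · simp
    · simp [pow_succ]

theorem actOn_shiftInto (p : V[X]) (b a : V) :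
    actOn D (shiftInto D p b) a = actOn D p (b * a) := by
  induction p using Polynomial.induction_on' with
  | add p q hp hq =>
    have hadd : shiftInto D (p + q) b = shiftInto D p b + shiftInto D q b :=
      Polynomial.sum_add_index p q _ (by simp) (fun n x y => by rw [map_add, add_mul])
    rw [hadd, map_add, map_add, LinearMap.add_apply, LinearMap.add_apply, hp, hq]
  | monomial n x =>
    rw [shiftInto, Polynomial.sum_monomial_index _ _ (by simp), actOn_C_mul, actOn_lamD_pow,
      actOn_C, actOn_monomial]

/-- The map `(b, a) ↦ {b_∂ c} a`. -/
def bracketPairing (lb : LambdaBracket D) (c : V) : V →+ V →+ V :=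
  AddMonoidHom.mk' (fun b => (actOn D (lb.br b c)).toAddMonoidHom) fun b b' => by
    ext a
    simp

theorem bracketPairing_apply (lb : LambdaBracket D) (c b a : V) :
    bracketPairing lb c b a = actOn D (lb.br b c) a := rfl

theorem isDerivationPairing_bracketPairing (lb : LambdaBracket D) (c : V) :
    IsDerivationPairing D (bracketPairing lb c) where
  isCyclicDerivation b b' a := by
    simp only [bracketPairing_apply]
    rw [lb.leibniz_left, map_add, LinearMap.add_apply, actOn_shiftInto, actOn_shiftInto,
      mul_comm b]
  deriv b a := by
    simp only [bracketPairing_apply]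
    rw [lb.sesq_left, map_neg, LinearMap.neg_apply, actOn_X_mul]

end Action

section Symbols

variable {F V : Type*} [Field F] [CommRing V] [Algebra F V] {D : Derivation F V V}

open PseudoDiffOp

/-- The pseudodifferential operator `X` has the symbol `f(w)|_{λ = ∂} a`, where `f(w)` is a series
in `w⁻¹` with coefficients in `V[λ]`. -/
structure IsSymbolOf (D : Derivation F V V) (f : ℤ → V[X]) (a : V) (X : PseudoDiffOp D) :
    Prop where
  bounded : ∃ M, ∀ n, M < n → f n = 0
  actOn_eq : ∀ n, actOn D (f n) a = X.coeff n

theorem isSymbolOf_zero (a : V) : IsSymbolOf D 0 a 0 where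
  bounded := ⟨0, fun _ _ => rfl⟩
  actOn_eq n := by simp

theorem isSymbolOf_C (X : PseudoDiffOp D) (a : V) :
    IsSymbolOf D (fun n => Polynomial.C (X.coeff n)) a (const D a * X) where
  bounded := X.bounded.imp fun N hN n hn => by rw [hN n hn, map_zero]
  actOn_eq n := by rw [actOn_C, coeff_const_mul, mul_comm]

theorem shiftPow_zero (r : ℤ) : shiftPow D r 0 = 0 :=
  funext fun n => by simp [shiftPow]

theorem actOn_finsum {α : Type*} {f : α → V[X]} (hf : f.HasFiniteSupport) (a : V) :
    actOn D (∑ᶠ i, f i) a = ∑ᶠ i, actOn D (f i) a :=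
  map_finsum ((actOn D).flip a) hf

namespace IsSymbolOf

theorem shiftPow {f : ℤ → V[X]} {a : V} {X : PseudoDiffOp D} (h : IsSymbolOf D f a X) (r : ℤ) :
    IsSymbolOf D (shiftPow D r f) a (dPow D r * X) where
  bounded := by
    obtain ⟨M, hM⟩ := h.bounded
    refine ⟨M + r, fun n hn => finsum_eq_zero_of_forall_eq_zero fun s => ?_⟩
    rw [hM _ (by omega), map_zero, smul_zero]
  actOn_eq n := by
    obtain ⟨M, hM⟩ := h.bounded
    have hfin : Function.HasFiniteSupport fun s : ℕ =>
        Ring.choose r s • (lamD D ^ s) (f (n - r + s)) := by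
      refine (Set.finite_Iic (M - n + r).toNat).subset fun s hs => ?_
      by_contra hc
      rw [Set.mem_Iic] at hc
      exact hs (by simp only [hM (n - r + s) (by omega), map_zero, smul_zero])
    rw [AdlerType.shiftPow, actOn_finsum hfin, coeff_dPow_mul]
    exact finsum_congr fun s => by
      rw [map_zsmul, LinearMap.smul_apply, actOn_lamD_pow, h.actOn_eq]

theorem finsum {α : Type*} {f : α → ℤ → V[X]} {a : V} {X : α → PseudoDiffOp D}
    (h : ∀ i, IsSymbolOf D (f i) a (X i)) (hf : f.HasFiniteSupport) :
    IsSymbolOf D (fun n => ∑ᶠ i, f i n) a (∑ᶠ i, X i) where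
  bounded := by
    choose M hM using fun i => (h i).bounded
    refine ⟨∑ i ∈ hf.toFinset, |M i|, fun n hn => finsum_eq_zero_of_forall_eq_zero fun i => ?_⟩
    by_cases hi : f i = 0
    · rw [hi, Pi.zero_apply]
    · have hle : |M i| ≤ ∑ i ∈ hf.toFinset, |M i| :=
        Finset.single_le_sum (fun j _ => abs_nonneg (M j)) (hf.mem_toFinset.2 hi)
      exact hM i n ((le_abs_self _).trans_lt (hle.trans_lt hn))
  actOn_eq n := by
    have hX : X.HasFiniteSupport := hf.subset fun i hi hfi => hi (PseudoDiffOp.ext (funext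
      fun n => by rw [← (h i).actOn_eq, hfi, Pi.zero_apply, map_zero]; rfl))
    have hfn : Function.HasFiniteSupport fun i => f i n :=
      hf.subset fun i hi hfi => hi (by simp only [hfi, Pi.zero_apply])
    rw [actOn_finsum hfn, finsum_congr fun i => (h i).actOn_eq n]
    exact (map_finsum (coeffHom n) hX).symm

theorem actOn_symbolShift {f : ℤ → V[X]} {a : V} {X : PseudoDiffOp D} (h : IsSymbolOf D f a X)
    (Q : PseudoDiffOp D) (n : ℤ) : actOn D (symbolShift Q f n) a = (Q * X).coeff n := by
  obtain ⟨M, hM⟩ := h.bounded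
  obtain ⟨N, hN⟩ := Q.exists_mem_filtration
  have hfin : Function.HasFiniteSupport fun q : ℤ =>
      Polynomial.C (Q.coeff q) * AdlerType.shiftPow D q f n := by
    refine (Set.finite_Icc (n - M) N).subset fun q hq => ?_
    by_contra hc
    rw [Set.mem_Icc, not_and_or, not_le, not_le] at hc
    refine hq ?_
    rcases hc with hc | hc
    · have hshift : AdlerType.shiftPow D q f n = 0 :=
        finsum_eq_zero_of_forall_eq_zero fun s => by
          rw [hM _ (by omega), map_zero, smul_zero]
      simp only [hshift, mul_zero]
    · simp only [hN q hc, map_zero, zero_mul]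
  rw [symbolShift, actOn_finsum hfin, coeff_mul_eq_finsum_dPow_mul]
  exact finsum_congr fun q => by rw [actOn_C_mul, (h.shiftPow q).actOn_eq]

theorem actOn_symbolMul {g : ℤ → ℤ → V[X]} {a : V} {X : ℤ → PseudoDiffOp D}
    (h : ∀ m, IsSymbolOf D (g m) a (X m)) {M : ℤ} (hg : ∀ m, M < m → g m = 0)
    (Q : PseudoDiffOp D) (m n : ℤ) :
    actOn D (symbolMul Q g m n) a = ∑ᶠ q : ℤ, Q.coeff q * (X (m - q)).coeff n := by
  obtain ⟨N, hN⟩ := Q.exists_mem_filtration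
  have hfin : Function.HasFiniteSupport fun q : ℤ =>
      Polynomial.C (Q.coeff q) * g (m - q) n := by
    refine (Set.finite_Icc (m - M) N).subset fun q hq => ?_
    by_contra hc
    rw [Set.mem_Icc, not_and_or, not_le, not_le] at hc
    refine hq ?_
    rcases hc with hc | hc
    · simp only [hg (m - q) (by omega), Pi.zero_apply, mul_zero]
    · simp only [hN q hc, map_zero, zero_mul]
  rw [symbolMul, actOn_finsum hfin]
  exact finsum_congr fun q => by rw [actOn_C_mul, (h _).actOn_eq]

end IsSymbolOf

theorem symbolW_of_ne_zero (X : PseudoDiffOp D) {m : ℤ} (hm : m ≠ 0) : symbolW X m = 0 :=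
  funext fun _ => if_neg hm

theorem resolvent_symbolW_of_nonneg (X : PseudoDiffOp D) {m : ℤ} (hm : 0 ≤ m) :
    resolvent D (symbolW X) m = 0 :=
  funext fun n => finsum_eq_zero_of_forall_eq_zero fun p => by
    rw [symbolW_of_ne_zero X (by omega), shiftPow_zero, Pi.zero_apply]

theorem isSymbolOf_resolvent_symbolW (X : PseudoDiffOp D) (a : V) (m : ℤ) :
    IsSymbolOf D (resolvent D (symbolW X) m) a ((dPow D (-m - 1)).posPart * (const D a * X)) := by
  rw [posPart_dPow]
  split_ifs with hm
  · obtain ⟨p, hp⟩ := Int.eq_ofNat_of_zero_le hm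
    have hres : resolvent D (symbolW X) m =
        shiftPow D p (fun n => Polynomial.C (X.coeff n)) := by
      funext n
      rw [resolvent, finsum_eq_single _ p fun q hq => ?_]
      · congr 1
        exact funext fun n => if_pos (by omega)
      · rw [symbolW_of_ne_zero X (by omega), shiftPow_zero, Pi.zero_apply]
    rw [hres, hp]
    exact (isSymbolOf_C X a).shiftPow p
  · rw [resolvent_symbolW_of_nonneg X (by omega), zero_mul]
    exact isSymbolOf_zero a

theorem actOn_symbolMul_resolvent_symbolW (Q X : PseudoDiffOp D) (a : V) (m n : ℤ) :
    actOn D (symbolMul Q (resolvent D (symbolW X)) m n) a =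
      ((Q * dPow D (-m - 1)).posPart * (const D a * X)).coeff n := by
  rw [IsSymbolOf.actOn_symbolMul (isSymbolOf_resolvent_symbolW X a) (M := 0)
    (fun k hk => resolvent_symbolW_of_nonneg X hk.le), coeff_posPart_mul_dPow_mul]
  refine finsum_congr fun q => ?_
  rw [show -(m - q) - 1 = q + (-m - 1) by ring]

theorem choose_neg_sub_one (m : ℤ) (k : ℕ) :
    Ring.choose (-m - 1) k = ((k : ℤ).negOnePow : ℤ) * Ring.choose (m + k) k := by
  rw [show -m - 1 = -(m + 1) by ring, Ring.choose_neg, show m + 1 + (k : ℤ) - 1 = m + k by ring,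
    Units.smul_def, smul_eq_mul]

theorem PseudoDiffOp.coeff_adjoint (X : PseudoDiffOp D) (m : ℤ) :
    X.adjoint.coeff m = (m.negOnePow : ℤ) • rightCoeff m X := by
  have hfin : Function.HasFiniteSupport fun s : ℕ =>
      Ring.choose (-m - 1) s • (D.toLinearMap ^ s) (X.coeff (m + s)) := by
    obtain ⟨N, hN⟩ := X.exists_mem_filtration
    refine (Set.finite_Iic (N - m).toNat).subset fun s hs => ?_
    by_contra hc
    rw [Set.mem_Iic] at hc
    exact hs (by simp only [hN (m + s) (by omega), map_zero, smul_zero])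
  rw [rightCoeff_apply, residue, coeff_dPow_mul, show -1 - (-m - 1) = m by ring,
    smul_finsum' _ hfin]
  refine finsum_congr fun s => ?_
  rw [smul_smul, choose_neg_sub_one, ← mul_assoc, ← Units.val_mul, ← Int.negOnePow_add]

theorem PseudoDiffOp.coeff_dPow_mul_const (m : ℤ) (a : V) (k : ℕ) :
    (dPow D m * const D a).coeff (m - k) = Ring.choose m k • (D.toLinearMap ^ k) a := by
  rw [coeff_dPow_mul, finsum_eq_single _ k fun s hs => ?_]
  · simp [coeff_const]
  · rw [coeff_const, if_neg (by omega), map_zero, smul_zero]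

theorem PseudoDiffOp.rightCoeff_const_mul (m : ℤ) (a : V) (X : PseudoDiffOp D) :
    rightCoeff m (const D a * X) = ∑ᶠ k : ℕ,
      (Ring.choose (-m - 1) k • (D.toLinearMap ^ k) a) * rightCoeff (m + k) X := by
  rw [rightCoeff_apply, ← mul_assoc, residue, coeff_mul_eq_finsum_dPow_mul,
    ← finsum_comp_equiv (Equiv.subLeft (-m - 1)), finsum_int_eq_finsum_nat fun k hk => by
      rw [Equiv.subLeft_apply, dPow_mul_const_mem_filtration (-m - 1) a _ (by omega), zero_mul]]
  refine finsum_congr fun k => ?_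
  rw [Equiv.subLeft_apply, coeff_dPow_mul_const, rightCoeff_apply, residue,
    show -(m + k) - 1 = -m - 1 - (k : ℤ) by ring]

theorem PseudoDiffOp.coeff_adjoint_mul_const (X : PseudoDiffOp D) (a : V) (m : ℤ) :
    (X.adjoint * const D a).coeff m = (m.negOnePow : ℤ) • rightCoeff m (const D a * X) := by
  have hfin : Function.HasFiniteSupport fun k : ℕ =>
      (Ring.choose (-m - 1) k • (D.toLinearMap ^ k) a) * rightCoeff (m + k) X := by
    obtain ⟨N, hN⟩ := X.exists_mem_filtration
    refine (Set.finite_Iic (N - m).toNat).subset fun k hk => ?_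
    by_contra hc
    rw [Set.mem_Iic] at hc
    exact hk (by simp only [rightCoeff_eq_zero hN (m := m + k) (by omega), mul_zero])
  rw [coeff_mul_const, rightCoeff_const_mul, smul_finsum' _ hfin]
  refine finsum_congr fun k => ?_
  have hsign : (m.negOnePow : ℤ) * ((k : ℤ).negOnePow : ℤ) = ((m + k).negOnePow : ℤ) := by
    rw [Int.negOnePow_add, Units.val_mul]
  rw [coeff_adjoint, choose_neg_sub_one, smul_mul_assoc, smul_smul, smul_mul_assoc, smul_smul,
    ← mul_assoc, hsign, mul_comm (_ : V), mul_comm (Ring.choose _ _)]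

theorem symbolReflect_eq_zero {Q : PseudoDiffOp D} {N : ℤ} (hQ : Q ∈ filtration D N) {m : ℤ}
    (hm : N < m) : symbolReflect Q m = 0 := by
  funext n
  have hterm (t : ℕ) : ((m.negOnePow : ℤ) * Ring.choose (m + t) t) •
      (Polynomial.C (Q.coeff (m + t)) * (Polynomial.X : V[X]) ^ t) = 0 := by
    rw [hQ _ (by omega), map_zero, zero_mul, smul_zero]
  simp only [symbolReflect, hterm, finsum_zero, ite_self, Pi.zero_apply]

theorem actOn_symbolReflect_zero (Q : PseudoDiffOp D) (m : ℤ) (a : V) :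
    actOn D (symbolReflect Q m 0) a = (m.negOnePow : ℤ) • (Q * const D a).coeff m := by
  obtain ⟨N, hN⟩ := Q.exists_mem_filtration
  have hsupp {M : Type _} [AddCommGroup M] (f : ℕ → V → M) (hf : ∀ t, f t 0 = 0) :
      Function.HasFiniteSupport fun t : ℕ => f t (Q.coeff (m + t)) := by
    refine (Set.finite_Iic (N - m).toNat).subset fun t ht => ?_
    by_contra hc
    rw [Set.mem_Iic] at hc
    exact ht (by simp only [hN (m + t) (by omega), hf])
  rw [symbolReflect, if_pos rfl, actOn_finsum (hsupp (fun t x =>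
      ((m.negOnePow : ℤ) * Ring.choose (m + t) t) • (Polynomial.C x * Polynomial.X ^ t))
      fun t => by simp),
    coeff_mul_const, smul_finsum' _ (hsupp (fun t x =>
      Ring.choose (m + t) t • (x * (D.toLinearMap ^ t) a)) fun t => by simp)]
  refine finsum_congr fun t => ?_
  rw [map_zsmul, LinearMap.smul_apply, Polynomial.C_mul_X_pow_eq_monomial, actOn_monomial,
    smul_smul]

theorem isSymbolOf_symbolReflect_adjoint (X : PseudoDiffOp D) (a : V) (m : ℤ) :
    IsSymbolOf D (symbolReflect X.adjoint m) a (const D (rightCoeff m (const D a * X))) where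
  bounded := ⟨0, fun _ hn => if_neg hn.ne'⟩
  actOn_eq n := by
    rcases eq_or_ne n 0 with rfl | hn
    · rw [actOn_symbolReflect_zero, coeff_adjoint_mul_const, smul_smul, ← Units.val_mul,
        ← Int.negOnePow_add, ← two_mul, Int.negOnePow_two_mul, Units.val_one, one_smul,
        coeff_const, if_pos rfl]
    · rw [symbolReflect, if_neg hn, map_zero, LinearMap.zero_apply, coeff_const, if_neg hn]

theorem isSymbolOf_resolvent_symbolReflect (X : PseudoDiffOp D) (a : V) (m : ℤ) :
    IsSymbolOf D (resolvent D (symbolReflect X.adjoint) m) a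
      (dPow D (-m - 1) * (const D a * X)).posPart := by
  obtain ⟨N, hN⟩ := X.adjoint.exists_mem_filtration
  have hfin : Function.HasFiniteSupport fun p : ℕ =>
      shiftPow D p (symbolReflect X.adjoint (m + p + 1)) := by
    refine (Set.finite_Iic (N - m - 1).toNat).subset fun p hp => ?_
    by_contra hc
    rw [Set.mem_Iic] at hc
    exact hp (by simp only [symbolReflect_eq_zero hN (m := m + p + 1) (by omega), shiftPow_zero])
  have h := IsSymbolOf.finsum (fun p : ℕ =>
    (isSymbolOf_symbolReflect_adjoint X a (m + p + 1)).shiftPow p) hfin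
  rw [posPart_eq_finsum_rightCoeff]
  have hidx (p : ℕ) : (p : ℤ) - (-m - 1) = m + p + 1 := by ring
  simp only [rightCoeff_dPow_mul, hidx]
  exact h

theorem IsAdlerType.actOn_br {lb : LambdaBracket D} {ι κ : Type*}
    {A : Matrix ι κ (PseudoDiffOp D)} (hA : IsAdlerType lb A) (i h : ι) (j k : κ) (m n : ℤ)
    (a : V) :
    actOn D (lb.br ((A i j).coeff m) ((A h k).coeff n)) a =
      (A h j * (dPow D (-m - 1) * (const D a * A i k)).posPart -
        (A h j * dPow D (-m - 1)).posPart * (const D a * A i k)).coeff n := by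
  rw [hA, map_sub, LinearMap.sub_apply, actOn_symbolMul_resolvent_symbolW,
    (isSymbolOf_resolvent_symbolReflect (A i k) a m).actOn_symbolShift]
  rfl

theorem PseudoDiffOp.eq_zero_of_map_dPow_mul_const {E : Type*} [AddCommGroup E]
    {φ : PseudoDiffOp D →+ E} {M : ℤ} (hφ : ∀ X ∈ filtration D M, φ X = 0)
    (h : ∀ m a, φ (dPow D m * const D a) = 0) : φ = 0 := by
  ext X
  rw [map_eq_finsum_rightCoeff φ hφ]
  exact finsum_eq_zero_of_forall_eq_zero fun m => h m _

theorem IsAdlerType.pairing_bracketPairing {lb : LambdaBracket D} {ι κ : Type*}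
    {A : Matrix ι κ (PseudoDiffOp D)} (hA : IsAdlerType lb A) (i h : ι) (j k : κ) (n : ℤ)
    (G : PseudoDiffOp D) :
    pairing (bracketPairing lb ((A h k).coeff n)) (A i j) G =
      (A h j * (G * A i k).posPart - (A h j * G).posPart * A i k).coeff n := by
  obtain ⟨M, hM⟩ := (A i j).exists_mem_filtration
  obtain ⟨N, hN⟩ := (A i k).exists_mem_filtration
  obtain ⟨P, hP⟩ := (A h j).exists_mem_filtration
  let rhs : PseudoDiffOp D →+ V := (coeffHom n).comp
    ((AddMonoidHom.mulLeft (A h j)).comp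
        ((posPartHom D).comp (AddMonoidHom.mulRight (A i k))) -
      (AddMonoidHom.mulRight (A i k)).comp
        ((posPartHom D).comp (AddMonoidHom.mulLeft (A h j))))
  have hrhs (G : PseudoDiffOp D) :
      rhs G = (A h j * (G * A i k).posPart - (A h j * G).posPart * A i k).coeff n := rfl
  have hzero : pairing (bracketPairing lb ((A h k).coeff n)) (A i j) - rhs = 0 := by
    refine eq_zero_of_map_dPow_mul_const (M := min (-2 - M) (min (-1 - N) (-1 - P)))
      (fun G hG => ?_) fun m a => ?_
    · rw [AddMonoidHom.sub_apply, hrhs, pairing_eq_zero _ hM hG (by omega),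
        posPart_of_mem_filtration (filtration_mono (by omega) (mul_mem_filtration hG hN)),
        posPart_of_mem_filtration (filtration_mono (by omega) (mul_mem_filtration hP hG)),
        mul_zero, zero_mul, sub_self, coeff_zero, sub_self]
    · rw [AddMonoidHom.sub_apply, hrhs, pairing_dPow_mul_const, bracketPairing_apply,
        hA.actOn_br, show -(-m - 1) - 1 = m by ring, mul_assoc, ← mul_assoc (A h j),
        posPart_mul_const, mul_assoc, sub_self]
  exact sub_eq_zero.1 (DFunLike.congr_fun hzero G)

end Symbols

section Matrices

variable {F V : Type*} [Field F] [CommRing V] [Algebra F V] {D : Derivation F V V}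
  {ι : Type*} [Fintype ι]

open PseudoDiffOp

theorem map_residue_trace_mul {E : Type*} [AddCommGroup E] (ρ : V →+ E)
    (X Y : Matrix ι ι (PseudoDiffOp D)) :
    ρ (residue (X * Y).trace) = ∑ i, ∑ j, ρ (residue (X i j * Y j i)) := by
  change ρ.comp (coeffHom (-1)) (X * Y).trace = ∑ i, ∑ j, ρ.comp (coeffHom (-1)) (X i j * Y j i)
  simp only [Matrix.trace, Matrix.diag, Matrix.mul_apply, map_sum]

theorem map_residue_trace_mul_comm {E : Type*} [AddCommGroup E] (ρ : V →+ E)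
    (hρ : ∀ a, ρ (D a) = 0) (X Y : Matrix ι ι (PseudoDiffOp D)) :
    ρ (residue (X * Y).trace) = ρ (residue (Y * X).trace) := by
  rw [map_residue_trace_mul, map_residue_trace_mul, Finset.sum_comm]
  exact Finset.sum_congr rfl fun j _ => Finset.sum_congr rfl fun i _ =>
    map_residue_mul_comm ρ hρ (X i j) (Y j i)

theorem IsAdlerType.matrixPairing_bracketPairing {lb : LambdaBracket D}
    {A : Matrix ι ι (PseudoDiffOp D)} (hA : IsAdlerType lb A) (h k : ι) (n : ℤ)
    (G : Matrix ι ι (PseudoDiffOp D)) :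
    matrixPairing (pairing (bracketPairing lb ((A h k).coeff n))) A G =
      ((A * (G * A).map posPart - (A * G).map posPart * A) h k).coeff n := by
  have hpos (X Y : Matrix ι ι (PseudoDiffOp D)) (i j : ι) :
      (X * Y).map posPart i j = ∑ l, (X i l * Y l j).posPart :=
    map_sum (posPartHom D) (fun l => X i l * Y l j) Finset.univ
  have hentry : (A * (G * A).map posPart - (A * G).map posPart * A) h k =
      ∑ i, ∑ j, (A h j * (G j i * A i k).posPart - (A h j * G j i).posPart * A i k) := by
    rw [Matrix.sub_apply, Matrix.mul_apply, Matrix.mul_apply]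
    simp only [hpos, Finset.mul_sum, Finset.sum_mul, Finset.sum_sub_distrib]
    rw [Finset.sum_comm]
  simp only [matrixPairing_apply, hA.pairing_bracketPairing, hentry, coeff_sum]

end Matrices

section Hamiltonians

variable {F V : Type*} [Field F] [CommRing V] [Algebra F V] {D : Derivation F V V} {N : ℕ}

open PseudoDiffOp

theorem intPow_units {R : Type*} [Ring R] (u : Rˣ) (n : ℤ) : intPow (u : R) n = ↑(u ^ n) := by
  cases n with
  | ofNat k => rw [intPow, Int.ofNat_eq_natCast, zpow_natCast, Units.val_pow_eq_pow_val]
  | negSucc k =>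
    rw [intPow, Ring.inverse_unit, zpow_negSucc, ← inv_pow, Units.val_pow_eq_pow_val]

theorem IsRoot.exists_units_zpow_eq {A B : MatPseudoDiffOp N D} {K : ℤ} (h : IsRoot A K B)
    (hA : IsUnit A) : ∃ u : (MatPseudoDiffOp N D)ˣ, (u : MatPseudoDiffOp N D) = B ∧
      (↑(u ^ K) : MatPseudoDiffOp N D) = A := by
  obtain ⟨hK, hneg, hpow⟩ := h
  have hB : IsUnit B := by
    rcases lt_or_gt_of_ne hK with hlt | hgt
    · exact hneg hlt
    · lift K to ℕ using hgt.le
      have hp : B ^ K = A := hpow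
      rw [← hp] at hA
      exact (isUnit_pow_iff (by omega)).1 hA
  obtain ⟨u, rfl⟩ := hB
  exact ⟨u, rfl, by rw [← intPow_units, hpow]⟩

theorem hamDensity_zero (K : ℤ) (B : MatPseudoDiffOp N D) : hamDensity K B 0 = 0 := if_pos rfl

theorem zsmul_hamDensity [CharZero F] (K : ℤ) (B : MatPseudoDiffOp N D) {n : ℤ} (hn : n ≠ 0) :
    n • hamDensity K B n = -(K • residue (intPow B n).trace) := by
  have hn' : (n : F) ≠ 0 := Int.cast_ne_zero.2 hn
  rw [hamDensity, if_neg hn, ← Int.cast_smul_eq_zsmul F, smul_smul, mul_div_cancel₀ _ hn',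
    neg_smul, Int.cast_smul_eq_zsmul]

/-- The variational derivative of `∫ h_{n,B}` with respect to `A = B ^ K` is `-B ^ (n - K)`. -/
theorem IsDerivationPairing.map_hamDensity [CharZero F] {E : Type*} [AddCommGroup E] [Module F E]
    {β : V →+ V →+ E} (hβ : IsDerivationPairing D β) (u : (MatPseudoDiffOp N D)ˣ) (K : ℤ) {n : ℤ}
    (hn : n ≠ 0) :
    β (hamDensity K (u : MatPseudoDiffOp N D) n) 1 =
      -matrixPairing (pairing β) (↑(u ^ K) : MatPseudoDiffOp N D)
        (↑(u ^ (n - K)) : MatPseudoDiffOp N D) := by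
  have hpow := hβ.isCyclicDerivation_pairing.matrixPairing.zsmul_zpow_one u K n
  rw [matrixPairing_one_right, pairing_one_right] at hpow
  have hden := congrArg (β.flip 1) (zsmul_hamDensity K (u : MatPseudoDiffOp N D) hn)
  rw [map_zsmul, map_neg, map_zsmul, intPow_units, AddMonoidHom.flip_apply,
    AddMonoidHom.flip_apply, hpow, ← smul_neg] at hden
  have hn' : (n : F) ≠ 0 := Int.cast_ne_zero.2 hn
  refine smul_right_injective E hn' ?_
  simpa only [Int.cast_smul_eq_zsmul] using hden

theorem flow_eq_bracketPairing (lb : LambdaBracket D) (f c : V) :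
    lb.flow (integral D f) c = bracketPairing lb c f 1 := by
  rw [bracketPairing_apply, actOn_one_right, lb.flow_integral]

theorem lax_equation [CharZero F] {lb : LambdaBracket D} {A : MatPseudoDiffOp N D}
    (hA : IsAdlerType lb A) (hinv : IsUnit A) {K : ℤ} {B : MatPseudoDiffOp N D}
    (hB : IsRoot A K B) (n : ℤ) :
    A.map (mapCoeff (lb.flow (integral D (hamDensity K B n)))) =
      ⁅(intPow B n).map posPart, A⁆ := by
  obtain ⟨u, rfl, hu⟩ := hB.exists_units_zpow_eq hinv
  rcases eq_or_ne n 0 with rfl | hn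
  · have hone : (1 : MatPseudoDiffOp N D).map posPart = 1 :=
      Matrix.map_one _ (map_zero (posPartHom D)) (posPart_of_mem_diffOps (one_mem _))
    rw [intPow_units, zpow_zero, Units.val_one, hone, Ring.lie_def, one_mul, mul_one, sub_self,
      hamDensity_zero, map_zero, map_zero]
    exact Matrix.ext fun i j => PseudoDiffOp.ext rfl
  · have hleft : (↑(u ^ (n - K)) : MatPseudoDiffOp N D) * A = ↑(u ^ n) := by
      rw [← hu, ← Units.val_mul, ← zpow_add, sub_add_cancel]
    have hright : A * (↑(u ^ (n - K)) : MatPseudoDiffOp N D) = ↑(u ^ n) := by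
      rw [← hu, ← Units.val_mul, ← zpow_add, add_sub_cancel]
    refine Matrix.ext fun h k => PseudoDiffOp.ext (funext fun m => ?_)
    change lb.flow (integral D (hamDensity K _ n)) ((A h k).coeff m) = _
    rw [flow_eq_bracketPairing, (isDerivationPairing_bracketPairing lb _).map_hamDensity u K hn,
      hu, hA.matrixPairing_bracketPairing, hleft, hright, intPow_units, Ring.lie_def]
    exact (map_neg (coeffHom (D := D) m) _).symm.trans (congrArg (coeffHom m) (neg_sub _ _))

/-- The derivation `d/dt` of `V` along the Hamiltonian flow of `H`. -/
def flowDerivation (lb : LambdaBracket D) (H : Functionals D) : Derivation F V V :=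
  Derivation.mk' (lb.flow H) fun a b => by
    obtain ⟨f, rfl⟩ := Submodule.mkQ_surjective _ H
    change (lb.br f (a * b)).coeff 0 = a * (lb.br f b).coeff 0 + b * (lb.br f a).coeff 0
    rw [lb.leibniz_right, Polynomial.coeff_add, Polynomial.coeff_mul_C, Polynomial.coeff_mul_C,
      add_comm, mul_comm b, mul_comm a]

theorem flowDerivation_comm (lb : LambdaBracket D) (H : Functionals D) (a : V) :
    flowDerivation lb H (D a) = D (flowDerivation lb H a) := by
  obtain ⟨f, rfl⟩ := Submodule.mkQ_surjective _ H
  change (lb.br f (D a)).coeff 0 = D ((lb.br f a).coeff 0)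
  rw [lb.sesq_right, lamD, LinearMap.add_apply, Polynomial.coeff_add, coeff_polyD]
  simp

/-- The pairing `(b, a) ↦ ∫ a δ(b)`, for a derivation `δ`. -/
def integralPairing (D δ : Derivation F V V) : V →+ V →+ Functionals D :=
  AddMonoidHom.mk' (fun b => (integral D).toAddMonoidHom.comp (AddMonoidHom.mulLeft (δ b)))
    fun b b' => AddMonoidHom.ext fun _ => by simp [add_mul]

theorem integralPairing_apply (δ : Derivation F V V) (b a : V) :
    integralPairing D δ b a = integral D (δ b * a) := rfl

theorem isDerivationPairing_integralPairing {δ : Derivation F V V}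
    (hδ : ∀ a, δ (D a) = D (δ a)) : IsDerivationPairing D (integralPairing D δ) where
  isCyclicDerivation b b' a := by
    simp only [integralPairing_apply, δ.leibniz, smul_eq_mul]
    rw [← map_add]
    congr 1
    ring
  deriv b a := by
    rw [integralPairing_apply, integralPairing_apply, hδ, eq_neg_iff_add_eq_zero, ← map_add,
      ← integral_D D (δ b * a), D.leibniz, smul_eq_mul, smul_eq_mul, add_comm, mul_comm a]

theorem pairing_integralPairing (δ : Derivation F V V) (X G : PseudoDiffOp D) :
    pairing (integralPairing D δ) X G =
      integral D (residue (mapCoeff (δ : V →ₗ[F] V) X * G)) := by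
  have hfin := pairing_finite AddMonoidHom.mul (mapCoeff (δ : V →ₗ[F] V) X) G
  rw [residue, coeff_mul_eq_finsum_dPow_mul]
  exact ((integral D).toAddMonoidHom.map_finsum hfin).symm

theorem integral_hamDensity_eq_zero [CharZero F] {δ : Derivation F V V}
    (hδ : ∀ a, δ (D a) = D (δ a)) {A P : MatPseudoDiffOp N D}
    (hlax : A.map (mapCoeff (δ : V →ₗ[F] V)) = ⁅P, A⁆) (hinv : IsUnit A) {L : ℤ}
    {C : MatPseudoDiffOp N D} (hC : IsRoot A L C) (n : ℤ) :
    integral D (δ (hamDensity L C n)) = 0 := by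
  obtain ⟨u, rfl, hu⟩ := hC.exists_units_zpow_eq hinv
  rcases eq_or_ne n 0 with rfl | hn
  · rw [hamDensity_zero, map_zero, map_zero]
  set G : MatPseudoDiffOp N D := ↑(u ^ (n - L)) with hG
  have hcomm : Commute A G := by
    rw [← hu, hG]
    exact ((Commute.refl u).zpow_zpow L (n - L)).units_val
  have htrace : integral D (residue (⁅P, A⁆ * G).trace) = 0 := by
    let ρ : V →+ Functionals D := (integral D).toAddMonoidHom
    have hcyc : ρ (residue (A * (P * G)).trace) = ρ (residue (P * G * A).trace) :=
      map_residue_trace_mul_comm ρ (integral_D D) _ _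
    change ρ.comp (coeffHom (-1)) _ = 0
    rw [Ring.lie_def, sub_mul, mul_assoc, hcomm.eq, mul_assoc A, Matrix.trace_sub, map_sub,
      ← mul_assoc]
    exact sub_eq_zero.2 hcyc.symm
  calc integral D (δ (hamDensity L (u : MatPseudoDiffOp N D) n))
      = integralPairing D δ (hamDensity L (u : MatPseudoDiffOp N D) n) 1 := by
        rw [integralPairing_apply, mul_one]
    _ = -matrixPairing (pairing (integralPairing D δ)) A G := by
        rw [(isDerivationPairing_integralPairing hδ).map_hamDensity u L hn, hu]
    _ = -integral D (residue (⁅P, A⁆ * G).trace) := by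
        rw [← hlax, matrixPairing_apply]
        simp only [pairing_integralPairing]
        exact congrArg Neg.neg (map_residue_trace_mul (integral D).toAddMonoidHom _ _).symm
    _ = 0 := by rw [htrace, neg_zero]

theorem funBracket_hamDensity_eq_zero [CharZero F] {lb : LambdaBracket D}
    {A : MatPseudoDiffOp N D} (hA : IsAdlerType lb A) (hinv : IsUnit A) {K L : ℤ}
    {B C : MatPseudoDiffOp N D} (hB : IsRoot A K B) (hC : IsRoot A L C) (m n : ℤ) :
    lb.funBracket (integral D (hamDensity K B m)) (integral D (hamDensity L C n)) = 0 :=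
  integral_hamDensity_eq_zero (flowDerivation_comm lb (integral D (hamDensity K B m)))
    (lax_equation hA hinv hB m) hinv hC n

theorem map_polynomial_sum {R M E G : Type*} [Semiring R] [AddCommMonoid M] [AddCommMonoid E]
    [FunLike G M E] [AddMonoidHomClass G M E] (φ : G) (p : R[X]) (f : ℕ → R → M) (h0 : f 0 0 = 0)
    (h : ∀ n x, n ≠ 0 → φ (f n x) = 0) : φ (p.sum f) = φ (f 0 (p.coeff 0)) := by
  rw [Polynomial.sum_def, map_sum]
  refine Finset.sum_eq_single 0 (fun n _ hn => h n _ hn) fun hp => ?_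
  rw [Polynomial.notMem_support_iff.1 hp, h0, map_zero]

theorem flow_jacobi {lb : LambdaBracket D} {W : Subalgebra F V} (hW : lb.IsPVASubalgebra W)
    {a b c : V} (ha : a ∈ W) (hb : b ∈ W) (hc : c ∈ W) :
    lb.flow (integral D a) (lb.flow (integral D b) c) -
      lb.flow (integral D b) (lb.flow (integral D a) c) =
    lb.flow (lb.funBracket (integral D a) (integral D b)) c := by
  let ev : V[X][X] →+* V := Polynomial.constantCoeff.comp Polynomial.constantCoeff
  have hev_C (p : V[X]) : ev (Polynomial.C p) = p.coeff 0 := by simp [ev]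
  have hev_X : ev Polynomial.X = 0 := by simp [ev]
  have hev_monomial (n : ℕ) (p : V[X]) (hn : n ≠ 0) : ev (Polynomial.monomial n p) = 0 := by
    rw [← Polynomial.C_mul_X_pow_eq_monomial, map_mul, map_pow, hev_X, zero_pow hn, mul_zero]
  have hev_C_X_pow_mul (n : ℕ) (r : V[X][X]) (hn : n ≠ 0) :
      ev (Polynomial.C (Polynomial.X ^ n) * r) = 0 := by
    rw [map_mul, hev_C, Polynomial.coeff_X_pow, if_neg hn.symm, zero_mul]
  have hev_map (p : V[X]) : ev (p.map Polynomial.C) = p.coeff 0 := by simp [ev]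
  have hev_eval₂ (p : V[X]) : ev (p.eval₂ (Polynomial.C.comp Polynomial.C)
      (Polynomial.C Polynomial.X + Polynomial.X)) = p.coeff 0 := by
    have hscalar : ev.comp (Polynomial.C.comp Polynomial.C) = RingHom.id V :=
      RingHom.ext fun x => by simp [ev]
    rw [Polynomial.hom_eval₂, hscalar, map_add, hev_C, hev_X, Polynomial.coeff_X_zero, add_zero,
      Polynomial.eval₂_id, Polynomial.coeff_zero_eq_eval_zero]
  have hjac := congrArg ev (hW.jacobi a ha b hb c hc)
  rw [map_sub, map_polynomial_sum _ _ _ (by simp) fun n x hn => hev_monomial n _ hn,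
    map_polynomial_sum _ _ _ (by simp) fun n x hn => hev_C_X_pow_mul n _ hn,
    map_polynomial_sum _ _ _ (by simp) fun n x hn => hev_C_X_pow_mul n _ hn] at hjac
  simp only [pow_zero, map_one, one_mul, Polynomial.monomial_zero_left, hev_C, hev_map,
    hev_eval₂] at hjac
  exact hjac

end Hamiltonians

end

end AdlerType

theorem theorem4p1 {F V : Type*} [Field F] [CharZero F] [CommRing V] [Algebra F V]
    (D : Derivation F V V) (lb : LambdaBracket D) (N : ℕ) (A : MatPseudoDiffOp N D)
    (hA : IsAdlerType lb A) (hinv : IsUnit A) :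
    -- the functionals are pairwise in involution
    (∀ (K L : ℤ) (B C : MatPseudoDiffOp N D), IsRoot A K B → IsRoot A L C → ∀ m n : ℤ,
      lb.funBracket (integral D (hamDensity K B m)) (integral D (hamDensity L C n)) = 0) ∧
    -- the Hamiltonian flows are the Lax equations
    (∀ (K : ℤ) (B : MatPseudoDiffOp N D), IsRoot A K B → ∀ n : ℤ,
      A.map (PseudoDiffOp.mapCoeff (lb.flow (integral D (hamDensity K B n)))) =
        ⁅(intPow B n).map PseudoDiffOp.posPart, A⁆) ∧
    -- the functionals are integrals of motion of all the flows
    (∀ (K L : ℤ) (B C : MatPseudoDiffOp N D), IsRoot A K B → IsRoot A L C → ∀ m n : ℤ,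
      lb.IsIntegralOfMotion (integral D (hamDensity K B m)) (integral D (hamDensity L C n))) ∧
    -- the flows commute on every Poisson vertex subalgebra containing the Hamiltonian densities
    (∀ W : Subalgebra F V, lb.IsPVASubalgebra W →
      ∀ (K L : ℤ) (B C : MatPseudoDiffOp N D), IsRoot A K B → IsRoot A L C → ∀ m n : ℤ,
        hamDensity K B m ∈ W → hamDensity L C n ∈ W → ∀ u ∈ W,
          lb.flow (integral D (hamDensity K B m)) (lb.flow (integral D (hamDensity L C n)) u) =
          lb.flow (integral D (hamDensity L C n)) (lb.flow (integral D (hamDensity K B m)) u)) := by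
  refine ⟨fun K L B C hB hC => funBracket_hamDensity_eq_zero hA hinv hB hC,
    fun K B hB => lax_equation hA hinv hB, fun K L B C hB hC m n g hg => ?_,
    fun W hW K L B C hB hC m n hm hn u hu => ?_⟩
  · have hinvol := funBracket_hamDensity_eq_zero hA hinv hB hC m n
    rwa [← hg] at hinvol
  · rw [← sub_eq_zero, flow_jacobi hW hm hn hu, funBracket_hamDensity_eq_zero hA hinv hB hC,
      map_zero, LinearMap.zero_apply]
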